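/- A represented space $\mathbf{X}=(X,\delta)$ is a set $X$ with a partial surjection $\delta:\subseteq\mathbb{N}^{\mathbb{N}}\to X$; if $\delta(p)=x$, then $p$ is a name of $x$. A map between represented spaces is computable (continuous) if some computable (continuous) partial function on Baire space sends every name of a point to a name of its image; an isomorphism is a bijection that is computable in both directions. The space $\mathbb{N}$ has $\delta(p)=p(0)$, and Sierpiński space $\mathbb{S}=\{\top,\bot\}$ has $0^\omega$ as the only name of $\bot$. The space of opens $\mathcal{O}(\mathbf{X})$ is the function space $\mathbb{S}^{\mathbf{X}}$ of continuous maps, where a name of a map is a code (an index of an oracle Turing machine together with an oracle) of a realiser. $\mathbf{X}$ is discrete if equality $\mathbf{X}\times\mathbf{X}\to\mathbb{S}$ is computable; it is overt if $U\mapsto(U\neq\emptyset):\mathcal{O}(\mathbf{X})\to\mathbb{S}$ is computable; it is admissible if the map $x\mapsto\{U\in\mathcal{O}(\mathbf{X}) : x\in U\}$ from $\mathbf{X}$ to $\mathcal{O}(\mathcal{O}(\mathbf{X}))$ has a computable partial inverse. $\mathbf{X}$ is computably Quasi-Polish if it is overt and isomorphic to the space of ideals of a transitive computably enumerable relation $\ll$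 on $\mathbb{N}$; here an ideal is a non-empty, downwards closed, upwards directed subset of $\mathbb{N}$, and its names are the sequences with it as range. For an equivalence relation $R$ on $\mathbb{N}$, the quotient $\mathbb{N}/R$ is the represented space in which an equivalence class is named by the names of its elements; $R$ is a ceer if it is computably enumerable. Let $\mathbf{X}$ be a non-empty represented space. (A) If $\mathbf{X}$ is discrete, then the following are equivalent: 1. $\mathbf{X}$ admits a computably equivalent representation with domain $\mathbb{N}^{\mathbb{N}}$ (that is, the two representations of the set $X$ can be computably translated into each other). 2. There is a computable surjection $s:\mathbb{N}\to\mathbf{X}$. 3. $\mathbf{X}$ is computably Quasi-Polish. 4. $\mathbf{X}$ is isomorphic to $\mathbb{N}/R$ for some equivalence relation $R$ on $\mathbb{N}$ such that $\mathbb{N}/R$ is discrete. 5. $\mathbf{X}$ is isomorphic to $\mathbb{N}/R$ for some equivalence relation $R$ on $\mathbb{N}$ such that $\mathbb{N}/R$ is admissible. (B) Without the assumption that $\mathbf{X}$ is discrete, the following are equivalent: 1. $\mathbf{X}$ is discrete and computably Quasi-Polish. 2. There is an equivalence relation $R$ on $\mathbb{N}$ such that $\mathbb{N}/R$ is admissible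 and $\mathbf{X}$ is isomorphic to $\mathbb{N}/R$. 3. There is a ceer $R$ such that $\mathbf{X}$ is isomorphic to $\mathbb{N}/R$. -/

import Mathlib

/-! ### Machines with an oracle -/

/-- The machine with program `c`, oracle `f : ℕ → ℕ` and input `n`. The program is an ordinary
partial recursive program that is given finitely many answers of the oracle: the pairs `(s, k)` are
run through in order, and in the round `(s, k)` the program runs for `s` steps on the finite list
`f 0, …, f (k - 1)` together with the input `n`. The output is that of the first round that halts;
if no round halts, the output is undefined. -/
def oracleEval (c : Nat.Partrec.Code) (f : ℕ → ℕ) (n : ℕ) : Part ℕ :=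
  Nat.rfindOpt fun m =>
    c.evaln m.unpair.1 (Encodable.encode ((List.range m.unpair.2).map f, n))

/-- On the argument `p`, the machine with program `c` computes the sequence `r`. -/
def Computes (c : Nat.Partrec.Code) (p r : ℕ → ℕ) : Prop :=
  ∀ n, r n ∈ oracleEval c p n

/-- The sequence with `p` on the even places and `q` on the odd places. -/
def join (p q : ℕ → ℕ) (n : ℕ) : ℕ :=
  if n % 2 = 0 then p (n / 2) else q (n / 2)

/-- The partial function on Baire space that is coded by `p` sends `q` to `r`: the number `p 0` is
the index of a program, and `n ↦ p (n + 1)` is an additional oracle for it. -/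
def CodeComputes (p q r : ℕ → ℕ) : Prop :=
  Computes (Denumerable.ofNat Nat.Partrec.Code (p 0)) (join (fun n => p (n + 1)) q) r

theorem join_even (p q : ℕ → ℕ) (n : ℕ) : join p q (2 * n) = p n := by
  simp [join]

theorem join_odd (p q : ℕ → ℕ) (n : ℕ) : join p q (2 * n + 1) = q n := by
  have h : (2 * n + 1) / 2 = n := by omega
  simp [join, h]

theorem Computes.unique {c : Nat.Partrec.Code} {p r r' : ℕ → ℕ}
    (h : Computes c p r) (h' : Computes c p r') : r = r' :=
  funext fun n => Part.mem_unique (h n) (h' n)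

/-- An output depends only on finitely many values of the oracle. -/
theorem oracleEval_use {c : Nat.Partrec.Code} {f : ℕ → ℕ} {n v : ℕ} (h : v ∈ oracleEval c f n) :
    ∃ k, ∀ g : ℕ → ℕ, (∀ i < k, g i = f i) → v ∈ oracleEval c g n := by
  obtain ⟨m, h0, h3⟩ := Part.mem_bind_iff.1 h
  obtain ⟨h1, h2⟩ := Nat.mem_rfind.1 h0
  refine ⟨m, fun g hg => ?_⟩
  have key : ∀ j ≤ m, (List.range j.unpair.2).map g = (List.range j.unpair.2).map f := by
    intro j hj
    refine List.map_congr_left fun i hi => hg i ?_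
    have := Nat.unpair_right_le j
    have := List.mem_range.1 hi
    omega
  refine Part.mem_bind_iff.2 ⟨m, Nat.mem_rfind.2 ⟨?_, fun {j} hj => ?_⟩, ?_⟩
  · beta_reduce; rw [key m le_rfl]; exact h1
  · beta_reduce; rw [key j hj.le]; exact h2 hj
  · beta_reduce; rw [key m le_rfl]; exact h3

/-- If a program gives no other output than `v` on the finite parts of the oracle, and gives it at
least once, then the machine outputs `v`. -/
theorem mem_oracleEval {c : Nat.Partrec.Code} {f : ℕ → ℕ} {n v : ℕ}
    (sound : ∀ k, ∀ v' ∈ c.eval (Encodable.encode ((List.range k).map f, n)), v' = v)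
    (halts : ∃ k, v ∈ c.eval (Encodable.encode ((List.range k).map f, n))) :
    v ∈ oracleEval c f n := by
  obtain ⟨k, hk⟩ := halts
  obtain ⟨s, hs⟩ := Nat.Partrec.Code.evaln_complete.1 hk
  have hdom : (oracleEval c f n).Dom := by
    rw [oracleEval, Nat.rfindOpt_dom]
    exact ⟨Nat.pair s k, v, by simpa using hs⟩
  obtain ⟨w, hw⟩ := Part.dom_iff_mem.1 hdom
  obtain ⟨m, hm⟩ := Nat.rfindOpt_spec hw
  have := sound _ w (Nat.Partrec.Code.evaln_sound hm)
  rwa [← this]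

/-- A search that reads a point `q` of Baire space on the odd places of the list `u`, and a table
that is indexed by finite sequences on the even places. -/
def tableStep (x : List ℕ × ℕ) (l : ℕ) : Option ℕ :=
  if 2 * l ≤ x.1.length then
    (x.1.getD (2 * Encodable.encode
      ((List.range l).map (fun i => x.1.getD (2 * i + 1) 0), x.2)) 0).casesOn none fun v => some v
  else none

theorem primrec_tableStep : Primrec₂ tableStep := by
  have hu : Primrec fun a : (List ℕ × ℕ) × ℕ => a.1.1 := Primrec.fst.comp Primrec.fst
  have hw : Primrec fun a : (List ℕ × ℕ) × ℕ =>
      (List.range a.2).map (fun i => a.1.1.getD (2 * i + 1) 0) := by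
    refine Primrec.list_map (Primrec.list_range.comp Primrec.snd) ?_
    refine (Primrec.list_getD 0).comp (hu.comp Primrec.fst) ?_
    exact Primrec.succ.comp (Primrec.nat_mul.comp (Primrec.const 2) Primrec.snd)
  have hidx : Primrec fun a : (List ℕ × ℕ) × ℕ => 2 * Encodable.encode
      ((List.range a.2).map (fun i => a.1.1.getD (2 * i + 1) 0), a.1.2) :=
    Primrec.nat_mul.comp (Primrec.const 2)
      (Primrec.encode.comp (hw.pair (Primrec.snd.comp Primrec.fst)))
  refine Primrec.ite ?_ ?_ (Primrec.const none)
  · exact Primrec.nat_le.comp (Primrec.nat_mul.comp (Primrec.const 2) Primrec.snd)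
      (Primrec.list_length.comp hu)
  · exact Primrec.nat_casesOn ((Primrec.list_getD 0).comp hu hidx) (Primrec.const none)
      (Primrec.option_some.comp Primrec.snd).to₂

/-- Every partial continuous function on Baire space has a code. -/
theorem exists_code_of_continuousOn {D : Set (ℕ → ℕ)} {F : (ℕ → ℕ) → ℕ → ℕ}
    (hF : ContinuousOn F D) : ∃ p, ∀ q ∈ D, CodeComputes p q (F q) := by
  classical
  have hpart : Nat.Partrec fun a => Part.bind (Encodable.decode (α := List ℕ × ℕ) a)
      fun x => (Nat.rfindOpt (tableStep x)).map Encodable.encode :=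
    Partrec.rfindOpt primrec_tableStep.to_comp
  obtain ⟨c, hc⟩ := Nat.Partrec.Code.exists_code.1 hpart
  let good : List ℕ → ℕ → ℕ → Prop := fun w n v =>
    ∀ q ∈ D, (List.range w.length).map q = w → F q n = v
  let T : ℕ → ℕ := fun a => ((Encodable.decode (α := List ℕ × ℕ) a).elim 0 fun x =>
    if h : ∃ v, good x.1 x.2 v then h.choose + 1 else 0)
  have hT : ∀ w n, T (Encodable.encode (w, n)) =
      if h : ∃ v, good w n v then h.choose + 1 else 0 := by
    intro w n
    simp only [T, Encodable.encodek, Option.elim_some]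
  refine ⟨fun n => n.casesOn (Encodable.encode c) T, fun q hq n => ?_⟩
  have hcode : Denumerable.ofNat Nat.Partrec.Code (Encodable.encode c) = c :=
    Denumerable.ofNat_encode c
  change F q n ∈ oracleEval (Denumerable.ofNat Nat.Partrec.Code (Encodable.encode c)) (join T q) n
  rw [hcode]
  have heval : ∀ u : List ℕ, c.eval (Encodable.encode (u, n)) = Nat.rfindOpt (tableStep (u, n)) := by
    intro u
    rw [hc]
    simp only [Encodable.encodek, Part.coe_some, Part.bind_some]
    exact Part.map_id' (fun _ => rfl) _
  have hget : ∀ k i, i < k → ((List.range k).map (join T q)).getD i 0 = join T q i := by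
    intro k i hi
    simp [List.getD_eq_getElem?_getD, hi]
  have hget' : ∀ k i, ¬ i < k → ((List.range k).map (join T q)).getD i 0 = 0 := by
    intro k i hi
    simp only [List.getD_eq_getElem?_getD]
    rw [List.getElem?_eq_none (by simpa using hi)]
    rfl
  have hw : ∀ k l, 2 * l ≤ k → (List.range l).map
      (fun i => ((List.range k).map (join T q)).getD (2 * i + 1) 0) = (List.range l).map q := by
    intro k l hl
    refine List.map_congr_left fun i hi => ?_
    have := List.mem_range.1 hi
    rw [hget k _ (by omega), join_odd]
  have hgood : ∀ l v, T (Encodable.encode ((List.range l).map q, n)) = v + 1 → F q n = v := by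
    intro l v h
    rw [hT] at h
    split_ifs at h with h'
    have h2 := h'.choose_spec q hq (by simp)
    omega
  apply mem_oracleEval
  · intro k v hv
    rw [heval] at hv
    obtain ⟨l, hl⟩ := Nat.rfindOpt_spec hv
    simp only [tableStep, List.length_map, List.length_range] at hl
    split_ifs at hl with hlk
    · rw [hw k l hlk] at hl
      by_cases hi : 2 * Encodable.encode ((List.range l).map q, n) < k
      · rw [hget k _ hi, join_even] at hl
        rcases hTv : T (Encodable.encode ((List.range l).map q, n)) with _ | v'
        · rw [hTv] at hl; simp at hl
        · rw [hTv] at hl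
          simp only [Option.mem_def, Option.some.injEq] at hl
          rw [hgood l v' hTv, hl]
      · rw [hget' k _ hi] at hl; simp at hl
    · simp at hl
  · obtain ⟨l, hl⟩ : ∃ l, good ((List.range l).map q) n (F q n) := by
      have hcont : ContinuousWithinAt (fun p => F p n) D q :=
        ((continuous_apply n).continuousAt).comp_continuousWithinAt (hF q hq)
      have hev : ∀ᶠ p in nhdsWithin q D, F p n = F q n :=
        hcont.eventually (IsOpen.mem_nhds (isOpen_discrete {F q n}) rfl)
      obtain ⟨U, hU, hqU, hUF⟩ := mem_nhdsWithin.1 hev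
      obtain ⟨I, V, hV, hIV⟩ := isOpen_pi_iff.1 hU q hqU
      refine ⟨I.sup id + 1, fun p hp hpw => hUF ⟨hIV fun i hi => ?_, hp⟩⟩
      have hpq : p i = q i := by
        have hlt : i < I.sup id + 1 := Nat.lt_succ_of_le (Finset.le_sup (f := id) hi)
        have := congrArg (fun w : List ℕ => w[i]?) hpw
        simpa [hlt] using this
      rw [hpq]
      exact (hV i hi).2
    have hTl : T (Encodable.encode ((List.range l).map q, n)) = F q n + 1 := by
      have hex : ∃ v, good ((List.range l).map q) n v := ⟨_, hl⟩
      rw [hT, dif_pos hex, hex.choose_spec q hq (by simp)]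
    have hlong : ∃ k, tableStep ((List.range k).map (join T q), n) l = some (F q n) := by
      refine ⟨2 * l + (2 * Encodable.encode ((List.range l).map q, n) + 1), ?_⟩
      simp only [tableStep, List.length_map, List.length_range]
      rw [if_pos (by omega), hw _ l (by omega), hget _ _ (by omega), join_even, hTl]
    obtain ⟨k, hk⟩ := hlong
    refine ⟨k, ?_⟩
    rw [heval]
    have hdom : (Nat.rfindOpt (tableStep ((List.range k).map (join T q), n))).Dom :=
      Nat.rfindOpt_dom.2 ⟨l, F q n, hk⟩
    obtain ⟨v, hv⟩ := Part.dom_iff_mem.1 hdom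
    obtain ⟨l', hl'⟩ := Nat.rfindOpt_spec hv
    simp only [tableStep, List.length_map, List.length_range] at hl'
    split_ifs at hl' with hlk
    · rw [hw k l' hlk] at hl'
      by_cases hi : 2 * Encodable.encode ((List.range l').map q, n) < k
      · rw [hget k _ hi, join_even] at hl'
        rcases hTv : T (Encodable.encode ((List.range l').map q, n)) with _ | v'
        · rw [hTv] at hl'; simp at hl'
        · rw [hTv] at hl'
          simp only [Option.mem_def, Option.some.injEq] at hl'
          rw [hgood l' v' hTv, hl']; exact hv
      · rw [hget' k _ hi] at hl'; simp at hl'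
    · simp at hl'

/-! ### Represented spaces -/

/-- A representation of `X`: a partial surjection from Baire space onto `X`, given by its graph
`IsName p x`, to be read as: `p` is a name of `x`. -/
structure BaireRepresentation (X : Type*) where
  /-- `p` is a name of `x`. -/
  IsName : (ℕ → ℕ) → X → Prop
  /-- The representation is a partial function. -/
  unique : ∀ {p x y}, IsName p x → IsName p y → x = y
  /-- The representation is surjective. -/
  surjective : ∀ x, ∃ p, IsName p x

/-- The domain of a representation. -/
def BaireRepresentation.dom {X : Type*} (δ : BaireRepresentation X) : Set (ℕ → ℕ) :=
  {p | ∃ x, δ.IsName p x}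

/-- A partial map between represented spaces is computable: it has a computable realiser. -/
def IsComputablePartialMap {X Y : Type*} (δX : BaireRepresentation X) (δY : BaireRepresentation Y)
    (F : X →. Y) : Prop :=
  ∃ c : Nat.Partrec.Code, ∀ p x y, δX.IsName p x → y ∈ F x →
    ∃ r, Computes c p r ∧ δY.IsName r y

/-- A map between represented spaces is computable: it has a computable realiser. -/
def IsComputableMap {X Y : Type*} (δX : BaireRepresentation X) (δY : BaireRepresentation Y)
    (f : X → Y) : Prop :=
  ∃ c : Nat.Partrec.Code, ∀ p x, δX.IsName p x → ∃ r, Computes c p r ∧ δY.IsName r (f x)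

/-- A map between represented spaces is continuous: it has a realiser that is continuous on the
names of points. -/
def IsContinuousMap {X Y : Type*} (δX : BaireRepresentation X) (δY : BaireRepresentation Y)
    (f : X → Y) : Prop :=
  ∃ F : (ℕ → ℕ) → (ℕ → ℕ), ContinuousOn F δX.dom ∧
    ∀ p x, δX.IsName p x → δY.IsName (F p) (f x)

/-- Computable isomorphism of represented spaces. -/
def IsComputablyIsomorphic {X Y : Type*} (δX : BaireRepresentation X) (δY : BaireRepresentation Y) : Prop :=
  ∃ e : X ≃ Y, IsComputableMap δX δY e ∧ IsComputableMap δY δX e.symm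

/-- Computable equivalence of two representations of the same set: each of them can be computably
translated into the other one. -/
def IsComputablyEquivalent {X : Type*} (δ δ' : BaireRepresentation X) : Prop :=
  IsComputableMap δ δ' id ∧ IsComputableMap δ' δ id

/-- The natural numbers: `p` is a name of `p 0`. -/
def natRep : BaireRepresentation ℕ where
  IsName p n := p 0 = n
  unique h h' := h.symm.trans h'
  surjective n := ⟨fun _ => n, rfl⟩

/-- Sierpinski space, with truth values as points: the zero sequence is the name of `False`, and all
other sequences are names of `True`. -/
def sierpinskiRep : BaireRepresentation Prop where
  IsName p P := P ↔ p ≠ 0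
  unique h h' := propext (h.trans h'.symm)
  surjective P := by
    by_cases hP : P
    · exact ⟨1, by simp [hP]⟩
    · exact ⟨0, by simp [hP]⟩

/-- The product of two represented spaces. -/
def prodRep {X Y : Type*} (δX : BaireRepresentation X) (δY : BaireRepresentation Y) :
    BaireRepresentation (X × Y) where
  IsName p z := δX.IsName (fun n => p (2 * n)) z.1 ∧ δY.IsName (fun n => p (2 * n + 1)) z.2
  unique h h' := Prod.ext (δX.unique h.1 h'.1) (δY.unique h.2 h'.2)
  surjective z := by
    obtain ⟨p, hp⟩ := δX.surjective z.1
    obtain ⟨q, hq⟩ := δY.surjective z.2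
    refine ⟨join p q, ?_, ?_⟩
    · simpa only [join_even] using hp
    · simpa only [join_odd] using hq

/-- The function space: a name of a continuous map `f` is a code of a realiser of `f`. -/
def expRep {X Y : Type*} (δX : BaireRepresentation X) (δY : BaireRepresentation Y) :
    BaireRepresentation {f : X → Y // IsContinuousMap δX δY f} where
  IsName p f := ∀ q x, δX.IsName q x → ∃ r, CodeComputes p q r ∧ δY.IsName r (f.1 x)
  unique := by
    rintro p f g hf hg
    refine Subtype.ext (funext fun x => ?_)
    obtain ⟨q, hq⟩ := δX.surjective x
    obtain ⟨r, hr, hrf⟩ := hf q x hq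
    obtain ⟨r', hr', hrg⟩ := hg q x hq
    obtain rfl := Computes.unique hr hr'
    exact δY.unique hrf hrg
  surjective := by
    rintro ⟨f, F, hF, hFf⟩
    obtain ⟨p, hp⟩ := exists_code_of_continuousOn hF
    exact ⟨p, fun q x hq => ⟨F q, hp q ⟨x, hq⟩, hFf q x hq⟩⟩

/-- The open subsets of a represented space, as continuous maps into Sierpinski space: the point `x`
belongs to `U` when `U.1 x` holds. -/
abbrev OpenSets {X : Type*} (δ : BaireRepresentation X) : Type _ :=
  {U : X → Prop // IsContinuousMap δ sierpinskiRep U}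

/-- The represented space of open subsets. -/
abbrev opensRep {X : Type*} (δ : BaireRepresentation X) : BaireRepresentation (OpenSets δ) :=
  expRep δ sierpinskiRep

/-- A subset is computably open: its characteristic function into Sierpinski space is computable. -/
def IsComputablyOpen {X : Type*} (δ : BaireRepresentation X) (U : Set X) : Prop :=
  IsComputableMap δ sierpinskiRep fun x => x ∈ U

/-- A represented space is computably discrete: the diagonal is computably open. -/
def IsComputablyDiscrete {X : Type*} (δ : BaireRepresentation X) : Prop :=
  IsComputablyOpen (prodRep δ δ) (Set.diagonal X)

/-- A represented space is computably overt: given an open set, one can semidecide whether it is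
non-empty. -/
def IsComputablyOvert {X : Type*} (δ : BaireRepresentation X) : Prop :=
  IsComputableMap (opensRep δ) sierpinskiRep fun U => ∃ x, U.1 x

/-- Membership of a fixed point is a continuous map on the open sets. -/
theorem isContinuousMap_mem {X : Type*} (δ : BaireRepresentation X) (x : X) :
    IsContinuousMap (opensRep δ) sierpinskiRep fun U => U.1 x := by
  classical
  obtain ⟨q, hq⟩ := δ.surjective x
  let F : (ℕ → ℕ) → (ℕ → ℕ) := fun p => if h : ∃ r, CodeComputes p q r then h.choose else 0
  have hF : ∀ p r, CodeComputes p q r → F p = r := by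
    intro p r hr
    have hex : ∃ r, CodeComputes p q r := ⟨r, hr⟩
    simp only [F, dif_pos hex]
    exact Computes.unique hex.choose_spec hr
  refine ⟨F, ?_, fun p U hp => ?_⟩
  · rintro p ⟨U, hp⟩
    refine continuousWithinAt_pi.2 fun n => ?_
    obtain ⟨r, hr, -⟩ := hp q x hq
    obtain ⟨k, hk⟩ := oracleEval_use (hr n)
    have hnear : ∀ᶠ p' in nhds p, ∀ i ∈ Finset.range (k + 1), p' i = p i := by
      rw [Filter.eventually_all_finset]
      intro i _
      exact (continuous_apply (A := fun _ : ℕ => ℕ) i).continuousAt.eventually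
        (p := fun m => m = p i) (IsOpen.mem_nhds (isOpen_discrete {p i}) rfl)
    have hev : ∀ᶠ p' in nhdsWithin p (opensRep δ).dom, F p' n = F p n := by
      filter_upwards [nhdsWithin_le_nhds hnear, self_mem_nhdsWithin] with p' hp' hdom
      obtain ⟨U', hU'⟩ := hdom
      obtain ⟨r', hr', -⟩ := hU' q x hq
      rw [hF p r hr, hF p' r' hr']
      refine Part.mem_unique (hr' n) ?_
      rw [hp' 0 (by simp)]
      refine hk _ fun i hi => ?_
      have : i / 2 + 1 ∈ Finset.range (k + 1) := by
        rw [Finset.mem_range]; omega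
      simp only [join, hp' _ this]
    exact (continuousWithinAt_const (b := F p n)).congr_of_eventuallyEq hev rfl
  · obtain ⟨r, hr, hrU⟩ := hp q x hq
    rw [hF p r hr]
    exact hrU

/-- The neighbourhood filter of a point: the open set of all open sets that contain the point. -/
def nbhdFilter {X : Type*} (δ : BaireRepresentation X) (x : X) : OpenSets (opensRep δ) :=
  ⟨fun U => U.1 x, isContinuousMap_mem δ x⟩

/-- A represented space is computably admissible: the map that sends a point to its neighbourhood
filter has a computable partial inverse. -/
def IsComputablyAdmissible {X : Type*} (δ : BaireRepresentation X) : Prop :=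
  ∃ G : OpenSets (opensRep δ) →. X,
    IsComputablePartialMap (opensRep (opensRep δ)) δ G ∧ ∀ x, x ∈ G (nbhdFilter δ x)

/-! ### Quasi-Polish spaces -/

/-- Ideals of a relation on the natural numbers. -/
structure RelIdeal (ll : ℕ → ℕ → Prop) where
  /-- The set of elements of the ideal. -/
  carrier : Set ℕ
  nonempty : carrier.Nonempty
  downwardsClosed : ∀ x, ∀ y ∈ carrier, ll x y → x ∈ carrier
  upwardsDirected : ∀ x ∈ carrier, ∀ y ∈ carrier, ∃ z ∈ carrier, ll x z ∧ ll y z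

/-- The space of ideals: a name of an ideal is an enumeration of its elements. -/
def idealRep (ll : ℕ → ℕ → Prop) : BaireRepresentation (RelIdeal ll) where
  IsName p I := I.carrier = Set.range p
  unique := by
    rintro p ⟨A, _, _, _⟩ ⟨B, _, _, _⟩ hA hB
    obtain rfl : A = B := hA.trans hB.symm
    rfl
  surjective I := by
    obtain ⟨p, hp⟩ := (Set.to_countable I.carrier).exists_eq_range I.nonempty
    exact ⟨p, hp⟩

/-- A binary relation on the natural numbers is computably enumerable. -/
def IsCERel (r : ℕ → ℕ → Prop) : Prop :=
  REPred fun a : ℕ × ℕ => r a.1 a.2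

/-- Precomputably Quasi-Polish spaces. -/
def IsPrecomputablyQuasiPolish {X : Type*} (δ : BaireRepresentation X) : Prop :=
  ∃ ll : ℕ → ℕ → Prop, (∀ x y z, ll x y → ll y z → ll x z) ∧ IsCERel ll ∧
    IsComputablyIsomorphic δ (idealRep ll)

/-- Computably Quasi-Polish spaces. -/
def IsComputablyQuasiPolish {X : Type*} (δ : BaireRepresentation X) : Prop :=
  IsPrecomputablyQuasiPolish δ ∧ IsComputablyOvert δ

/-! ### Quotients of the natural numbers -/

/-- The quotient of the natural numbers by an equivalence relation: a name of an equivalence class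
is a name of any representative of it. -/
def natQuotientRep (R : Setoid ℕ) : BaireRepresentation (Quotient R) where
  IsName p z := ∃ n, natRep.IsName p n ∧ Quotient.mk R n = z
  unique := by
    rintro p x y ⟨n, hn, rfl⟩ ⟨m, hm, rfl⟩
    rw [natRep.unique hn hm]
  surjective z := by
    obtain ⟨n, rfl⟩ := Quotient.exists_rep z
    obtain ⟨p, hp⟩ := natRep.surjective n
    exact ⟨p, n, hp, rfl⟩

/-- A ceer: a computably enumerable equivalence relation on the natural numbers. -/
def IsCeer (R : Setoid ℕ) : Prop :=
  IsCERel fun n m => R n m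

/-! Everything turns on a computable surjection `s : ℕ → X` onto a discrete space. All realisers
come from one principle, `exists_code_search`: a machine can search for values satisfying a
computably enumerable condition on finite prefixes of its oracle. `IsComputablyDiscrete.exists_re`
puts discreteness in this form, as a computably enumerable relation `E` between prefixes of names. A
list `w` with `E w w` cannot be a prefix of names of two different points.

This produces `s` in two situations. If the representation is total, every finite list padded with
zeros is a name. The test comparing a name `p` with itself reads only a prefix, so some padded list
names the same point as `p` (`exists_surjective_of_total`). If the space is quasi-Polish, overtness
makes it semidecidable whether a finite set lies in some ideal. The lists `w` with `E w w` that do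
so can therefore be enumerated; each determines one ideal, and `v` belongs to it if and only if `v
:: w` is still extendible (`exists_surjective_of_quasiPolish`).

Conversely, given `s`, discreteness allows a search for preimages. So `p ↦ s (p 0)` is an equivalent
total representation, and `X` is the quotient of `ℕ` by the kernel of `s`.

For a quotient of `ℕ`, being discrete, being admissible and having a computably enumerable `R`
coincide. The surprising direction is `isCeer_of_isComputablyAdmissible`, which fools the inverse of
the neighbourhood map by changing an oracle behind the part already read. Finally, the ideals of a
ceer are its classes, and the surjection from `ℕ` gives overtness, so the quotient is computably
quasi-Polish. -/

/-! ### Computably enumerable predicates -/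

section REPred

variable {α β : Type*} [Primcodable α] [Primcodable β]

/-- A computably enumerable predicate is the increasing union of stages that can be decided by a
primitive recursive function. -/
theorem REPred.exists_stages {P : α → Prop} (hP : REPred P) :
    ∃ T : α → ℕ → Bool, Primrec₂ T ∧ (∀ a s t, s ≤ t → T a s = true → T a t = true) ∧
      ∀ a, P a ↔ ∃ s, T a s = true := by
  obtain ⟨c, hc⟩ := Nat.Partrec.Code.exists_code.1 hP
  have hiff : ∀ a, P a ↔ (c.eval (Encodable.encode a)).Dom := by
    intro a
    rw [hc]
    simp [Part.assert]
  refine ⟨fun a s => (c.evaln s (Encodable.encode a)).isSome, ?_, ?_, ?_⟩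
  · exact Primrec.option_isSome.comp (Nat.Partrec.Code.primrec_evaln.comp
      ((Primrec.snd.pair (Primrec.const c)).pair (Primrec.encode.comp Primrec.fst)))
  · intro a s t hst h
    obtain ⟨v, hv⟩ := Option.isSome_iff_exists.1 h
    exact Option.isSome_iff_exists.2 ⟨v, Nat.Partrec.Code.evaln_mono hst hv⟩
  · intro a
    rw [hiff, Part.dom_iff_mem]
    constructor
    · rintro ⟨v, hv⟩
      obtain ⟨s, hs⟩ := Nat.Partrec.Code.evaln_complete.1 hv
      exact ⟨s, Option.isSome_iff_exists.2 ⟨v, hs⟩⟩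
    · rintro ⟨s, hs⟩
      obtain ⟨v, hv⟩ := Option.isSome_iff_exists.1 hs
      exact ⟨v, Nat.Partrec.Code.evaln_sound hv⟩

theorem REPred.of_stages {P : α → Prop} {T : α → ℕ → Bool} (hT : Computable₂ T)
    (h : ∀ a, P a ↔ ∃ s, T a s = true) : REPred P := by
  have h1 : Partrec fun a => Nat.rfindOpt fun s => bif T a s then some () else none :=
    Partrec.rfindOpt (Computable.cond hT (Computable.const _) (Computable.const _))
  refine h1.dom_re.of_eq fun a => ?_
  rw [Nat.rfindOpt_dom, h]
  refine exists_congr fun s => ?_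
  cases T a s <;> simp

theorem REPred.comp {P : β → Prop} (hP : REPred P) {f : α → β} (hf : Computable f) :
    REPred fun a => P (f a) :=
  Partrec.comp hP hf

theorem REPred.and {P Q : α → Prop} (hP : REPred P) (hQ : REPred Q) :
    REPred fun a => P a ∧ Q a := by
  obtain ⟨T, hT, mT, eT⟩ := hP.exists_stages
  obtain ⟨S, hS, mS, eS⟩ := hQ.exists_stages
  refine REPred.of_stages (T := fun a s => T a s && S a s) (Primrec.and.comp hT hS).to_comp ?_
  intro a
  simp only [eT, eS, Bool.and_eq_true]
  constructor
  · rintro ⟨⟨s, hs⟩, t, ht⟩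
    exact ⟨max s t, mT _ _ _ (le_max_left _ _) hs, mS _ _ _ (le_max_right _ _) ht⟩
  · rintro ⟨s, hs, ht⟩
    exact ⟨⟨s, hs⟩, s, ht⟩

theorem REPred.exists {P : α → β → Prop} (hP : REPred fun x : α × β => P x.1 x.2) :
    REPred fun a => ∃ b, P a b := by
  obtain ⟨T, hT, -, eT⟩ := hP.exists_stages
  -- Dovetailing: `m` codes a candidate `b` and a stage. Numbers that code no candidate count as
  -- failures.
  refine REPred.of_stages (T := fun a m =>
    ((Encodable.decode (α := β) m.unpair.1).map fun b => T (a, b) m.unpair.2).getD false) ?_ ?_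
  · refine Primrec.to_comp ?_
    refine Primrec.option_getD.comp (Primrec.option_map ?_ ?_) (Primrec.const false)
    · exact Primrec.decode.comp (Primrec.fst.comp (Primrec.unpair.comp Primrec.snd))
    · exact hT.comp ((Primrec.fst.comp Primrec.fst).pair Primrec.snd)
        (Primrec.snd.comp (Primrec.unpair.comp (Primrec.snd.comp Primrec.fst)))
  · intro a
    constructor
    · rintro ⟨b, hb⟩
      obtain ⟨s, hs⟩ := (eT (a, b)).1 hb
      exact ⟨Nat.pair (Encodable.encode b) s, by simpa using hs⟩
    · rintro ⟨m, hm⟩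
      rcases hd : Encodable.decode (α := β) m.unpair.1 with _ | b
      · simp [hd] at hm
      · exact ⟨b, (eT (a, b)).2 ⟨m.unpair.2, by simpa [hd] using hm⟩⟩

/-- The stages increase, so the finitely many witnesses for the members of the list can be replaced
by their maximum. -/
theorem REPred.forall_mem {P : α → β → Prop} (hP : REPred fun x : α × β => P x.1 x.2)
    {l : α → List β} (hl : Computable l) : REPred fun a => ∀ b ∈ l a, P a b := by
  obtain ⟨T, hT, mT, eT⟩ := hP.exists_stages
  have hR : PrimrecRel fun (b : β) (x : α × ℕ) => T (x.1, b) x.2 = true :=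
    Primrec.eq.comp (hT.comp ((Primrec.fst.comp Primrec.snd).pair Primrec.fst)
      (Primrec.snd.comp Primrec.snd)) (Primrec.const true)
  obtain ⟨hdec, hprim⟩ := hR.forall_mem_list
  refine REPred.of_stages (T := fun a s => @decide (∀ b ∈ l a, T (a, b) s = true)
    (hdec (l a, (a, s)))) ?_ ?_
  · exact hprim.to_comp.comp ((hl.comp Computable.fst).pair Computable.id)
  · intro a
    simp only [decide_eq_true_eq]
    have hP' : ∀ b, P a b ↔ ∃ s, T (a, b) s = true := fun b => eT (a, b)
    simp only [hP']
    generalize l a = L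
    induction L with
    | nil => simp
    | cons b L ih =>
      simp only [List.forall_mem_cons, ih]
      constructor
      · rintro ⟨⟨s, hs⟩, t, ht⟩
        exact ⟨max s t, mT _ _ _ (le_max_left _ _) hs,
          fun b hb => mT _ _ _ (le_max_right _ _) (ht b hb)⟩
      · rintro ⟨s, hs, ht⟩
        exact ⟨⟨s, hs⟩, s, ht⟩

/-- The graph of a partial computable function is computably enumerable. -/
theorem Partrec.graph_re {f : α →. ℕ} (hf : Partrec f) {v : α → ℕ} (hv : Computable v) :
    REPred fun a => v a ∈ f a := by
  -- This function diverges on a wrong value, so its domain is the required predicate.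
  have h : Partrec fun a => (f a).bind fun w => bif w == v a then Part.some () else Part.none := by
    refine hf.bind (Partrec.cond ?_ (Computable.const ()).partrec Partrec.none)
    exact Primrec.beq.to_comp.comp Computable.snd (hv.comp Computable.fst)
  refine h.dom_re.of_eq fun a => ?_
  rw [Part.dom_iff_mem]
  constructor
  · rintro ⟨u, hu⟩
    obtain ⟨w, hw, hu⟩ := Part.mem_bind_iff.1 hu
    by_cases hwv : w = v a
    · rwa [← hwv]
    · have : (w == v a) = false := by simpa using hwv
      rw [this] at hu
      exact absurd hu (Part.notMem_none _)
  · intro ha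
    exact ⟨(), Part.mem_bind_iff.2 ⟨v a, ha, by simp⟩⟩

theorem REPred.eq {f g : α → β} [DecidableEq β] (hf : Computable f) (hg : Computable g) :
    REPred fun a => f a = g a :=
  REPred.of_stages (T := fun a _ => decide (f a = g a))
    ((Primrec.eq (α := β)).decide.to_comp.comp (hf.comp Computable.fst) (hg.comp Computable.fst))
    (by simp)

theorem REPred.of_primrec {f : α → Bool} (hf : Primrec f) : REPred fun a => f a = true :=
  REPred.of_stages (T := fun a _ => f a) (hf.comp Primrec.fst).to_comp (by simp)

end REPred

/-! ### Initial segments -/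

/-- The list of the first `k` values of a sequence. -/
def initSeg (p : ℕ → ℕ) (k : ℕ) : List ℕ :=
  (List.range k).map p

@[simp]
theorem initSeg_length (p : ℕ → ℕ) (k : ℕ) : (initSeg p k).length = k := by
  simp [initSeg]

theorem initSeg_getD (p : ℕ → ℕ) {k i : ℕ} (h : i < k) : (initSeg p k).getD i 0 = p i := by
  simp [initSeg, List.getD_eq_getElem?_getD, h]

theorem initSeg_getElem? (p : ℕ → ℕ) {k i : ℕ} (h : i < k) : (initSeg p k)[i]? = some (p i) := by
  simp [initSeg, h]

theorem eq_of_initSeg_getElem? {p : ℕ → ℕ} {k i a : ℕ} (h : (initSeg p k)[i]? = some a) :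
    p i = a := by
  have hlt : i < k := by
    by_contra hik
    rw [List.getElem?_eq_none (by simpa using hik)] at h
    cases h
  rw [initSeg_getElem? p hlt] at h
  exact Option.some.inj h

theorem initSeg_take (p : ℕ → ℕ) {k j : ℕ} (h : j ≤ k) : (initSeg p k).take j = initSeg p j := by
  rw [initSeg, ← List.map_take, List.take_range, Nat.min_eq_left h, initSeg]

theorem initSeg_congr {p q : ℕ → ℕ} {k : ℕ} (h : ∀ i < k, p i = q i) : initSeg p k = initSeg q k :=
  List.map_congr_left fun i hi => h i (List.mem_range.1 hi)

theorem eq_initSeg_of_getD {w : List ℕ} {p : ℕ → ℕ} (h : ∀ i < w.length, w.getD i 0 = p i) :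
    w = initSeg p w.length := by
  refine List.ext_getElem (by simp) fun i hi _ => ?_
  have := h i hi
  rw [List.getD_eq_getElem _ _ hi] at this
  simp [initSeg, this]

theorem mem_initSeg {p : ℕ → ℕ} {k a : ℕ} : a ∈ initSeg p k ↔ ∃ i < k, p i = a := by
  simp [initSeg]

theorem primrec_initSeg {α : Type*} [Primcodable α] {f : α → ℕ → ℕ} {k : α → ℕ} (hf : Primrec₂ f)
    (hk : Primrec k) : Primrec fun a => initSeg (f a) (k a) :=
  Primrec.list_map (Primrec.list_range.comp hk) hf

/-- The finite counterpart of `join`. -/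
def interleave (u w : List ℕ) : List ℕ :=
  initSeg (join (fun i => u.getD i 0) fun i => w.getD i 0) (2 * min u.length w.length)

/-- The entries of a list at the even places. -/
def evenPart (z : List ℕ) : List ℕ :=
  initSeg (fun i => z.getD (2 * i) 0) (z.length / 2)

/-- The entries of a list at the odd places. -/
def oddPart (z : List ℕ) : List ℕ :=
  initSeg (fun i => z.getD (2 * i + 1) 0) (z.length / 2)

/-- Cutting both lists to the shorter length makes the result a genuine prefix of the joined
sequence, without padding. -/
theorem interleave_initSeg (p q : ℕ → ℕ) (k l : ℕ) :
    interleave (initSeg p k) (initSeg q l) = initSeg (join p q) (2 * min k l) := by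
  rw [interleave, initSeg_length, initSeg_length]
  refine initSeg_congr fun i hi => ?_
  simp only [join]
  rw [initSeg_getD p (by omega), initSeg_getD q (by omega)]

theorem evenPart_initSeg (p : ℕ → ℕ) (k : ℕ) :
    evenPart (initSeg p k) = initSeg (fun n => p (2 * n)) (k / 2) := by
  rw [evenPart, initSeg_length]
  exact initSeg_congr fun i hi => initSeg_getD p (by omega)

theorem oddPart_initSeg (p : ℕ → ℕ) (k : ℕ) :
    oddPart (initSeg p k) = initSeg (fun n => p (2 * n + 1)) (k / 2) := by
  rw [oddPart, initSeg_length]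
  exact initSeg_congr fun i hi => initSeg_getD p (by omega)

theorem initSeg_tail (p : ℕ → ℕ) (k : ℕ) :
    (initSeg p k).tail = initSeg (fun n => p (n + 1)) (k - 1) := by
  rcases k with _ | k
  · rfl
  · simp [initSeg, List.range_succ_eq_map, Function.comp_def]

theorem primrec_getD {α : Type*} [Primcodable α] {w : α → List ℕ} {i : α → ℕ} (hw : Primrec w)
    (hi : Primrec i) : Primrec fun a => (w a).getD (i a) 0 :=
  (Primrec.list_getD 0).comp hw hi

theorem primrec_interleave {α : Type*} [Primcodable α] {u w : α → List ℕ} (hu : Primrec u)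
    (hw : Primrec w) : Primrec fun a => interleave (u a) (w a) := by
  refine primrec_initSeg ?_ ?_
  · refine Primrec.ite ?_ ?_ ?_
    · exact Primrec.eq.comp (Primrec.nat_mod.comp Primrec.snd (Primrec.const 2)) (Primrec.const 0)
    · exact primrec_getD (hu.comp Primrec.fst)
        (Primrec.nat_div.comp Primrec.snd (Primrec.const 2))
    · exact primrec_getD (hw.comp Primrec.fst)
        (Primrec.nat_div.comp Primrec.snd (Primrec.const 2))
  · exact Primrec.nat_mul.comp (Primrec.const 2)
      (Primrec.nat_min.comp (Primrec.list_length.comp hu) (Primrec.list_length.comp hw))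

theorem primrec_evenPart : Primrec evenPart :=
  primrec_initSeg (primrec_getD Primrec.fst (Primrec.nat_mul.comp (Primrec.const 2) Primrec.snd))
    (Primrec.nat_div.comp Primrec.list_length (Primrec.const 2))

theorem primrec_oddPart : Primrec oddPart :=
  primrec_initSeg (primrec_getD Primrec.fst
      (Primrec.succ.comp (Primrec.nat_mul.comp (Primrec.const 2) Primrec.snd)))
    (Primrec.nat_div.comp Primrec.list_length (Primrec.const 2))

/-! ### Finite runs of machines -/

/-- The round `m` of the machine with a program on an input, when only a finite part of the oracle
is known. -/
def prefixRun (x : (Nat.Partrec.Code × List ℕ) × ℕ) (m : ℕ) : Option ℕ :=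
  if m ≤ x.1.2.length then
    x.1.1.evaln m.unpair.1 (Encodable.encode (x.1.2.take m.unpair.2, x.2)) else none

/-- The machine with program `c` outputs `v` on the input `n` when it reads only the finite part `w`
of its oracle. -/
def PrefixOutput (c : Nat.Partrec.Code) (w : List ℕ) (n v : ℕ) : Prop :=
  v ∈ Nat.rfindOpt (prefixRun ((c, w), n))

theorem Nat.mem_rfindOpt_iff {f : ℕ → Option ℕ} {v : ℕ} :
    v ∈ Nat.rfindOpt f ↔ ∃ m, f m = some v ∧ ∀ j < m, f j = none := by
  constructor
  · intro h
    obtain ⟨m, h0, h3⟩ := Part.mem_bind_iff.1 h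
    obtain ⟨-, h2⟩ := Nat.mem_rfind.1 h0
    refine ⟨m, by simpa using h3, fun j hj => ?_⟩
    have := h2 hj
    simpa using this
  · rintro ⟨m, hm, hj⟩
    refine Part.mem_bind_iff.2 ⟨m, Nat.mem_rfind.2 ⟨?_, fun {j} h => ?_⟩, ?_⟩
    · simp [hm]
    · simp [hj j h]
    · simp [hm]

/-- Round `m` reads `m.unpair.2 ≤ m` oracle values. The guard in `prefixRun` thus admits only rounds
whose oracle values are all known, and on those it agrees with the true run. -/
theorem mem_oracleEval_iff {c : Nat.Partrec.Code} {f : ℕ → ℕ} {n v : ℕ} :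
    v ∈ oracleEval c f n ↔ ∃ k, PrefixOutput c (initSeg f k) n v := by
  constructor
  · intro h
    obtain ⟨m, hm, hj⟩ := Nat.mem_rfindOpt_iff.1 h
    refine ⟨m, Nat.mem_rfindOpt_iff.2 ⟨m, ?_, fun j hjm => ?_⟩⟩
    · rw [prefixRun, if_pos (by simp), initSeg_take _ (Nat.unpair_right_le m)]
      exact hm
    · rw [prefixRun, if_pos (by simpa using hjm.le), initSeg_take _ ((Nat.unpair_right_le j).trans hjm.le)]
      exact hj j hjm
  · rintro ⟨k, h⟩
    obtain ⟨m, hm, hj⟩ := Nat.mem_rfindOpt_iff.1 h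
    have hmk : m ≤ k := by
      by_contra hmk
      rw [prefixRun, if_neg (by simpa using hmk)] at hm
      cases hm
    refine Nat.mem_rfindOpt_iff.2 ⟨m, ?_, fun j hjm => ?_⟩
    · rw [prefixRun, if_pos (by simpa using hmk), initSeg_take _ ((Nat.unpair_right_le m).trans hmk)] at hm
      exact hm
    · have := hj j hjm
      rw [prefixRun, if_pos (by simp; omega), initSeg_take _ ((Nat.unpair_right_le j).trans (by omega))] at this
      exact this

theorem PrefixOutput.mem_oracleEval {c : Nat.Partrec.Code} {f : ℕ → ℕ} {k n v : ℕ}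
    (h : PrefixOutput c (initSeg f k) n v) : v ∈ oracleEval c f n :=
  mem_oracleEval_iff.2 ⟨k, h⟩

theorem PrefixOutput.eq_of_computes {c : Nat.Partrec.Code} {p r : ℕ → ℕ} {k n v : ℕ}
    (h : PrefixOutput c (initSeg p k) n v) (hr : Computes c p r) : v = r n :=
  Part.mem_unique h.mem_oracleEval (hr n)

theorem PrefixOutput.mono {c : Nat.Partrec.Code} {f : ℕ → ℕ} {k l n v : ℕ} (hkl : k ≤ l)
    (h : PrefixOutput c (initSeg f k) n v) : PrefixOutput c (initSeg f l) n v := by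
  obtain ⟨m, hm, hj⟩ := Nat.mem_rfindOpt_iff.1 h
  have hmk : m ≤ k := by
    by_contra hmk
    rw [prefixRun, if_neg (by simpa using hmk)] at hm
    cases hm
  refine Nat.mem_rfindOpt_iff.2 ⟨m, ?_, fun j hjm => ?_⟩
  · rw [prefixRun, if_pos (by simpa using hmk), initSeg_take _ ((Nat.unpair_right_le m).trans hmk)] at hm
    rw [prefixRun, if_pos (by simp; omega), initSeg_take _ ((Nat.unpair_right_le m).trans (by omega))]
    exact hm
  · have := hj j hjm
    rw [prefixRun, if_pos (by simp; omega), initSeg_take _ ((Nat.unpair_right_le j).trans (by omega))] at this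
    rw [prefixRun, if_pos (by simp; omega), initSeg_take _ ((Nat.unpair_right_le j).trans (by omega))]
    exact this

theorem PrefixOutput.re {α : Type*} [Primcodable α] {c : α → Nat.Partrec.Code} {w : α → List ℕ}
    {n v : α → ℕ} (hc : Computable c) (hw : Computable w) (hn : Computable n) (hv : Computable v) :
    REPred fun a => PrefixOutput (c a) (w a) (n a) (v a) := by
  have key : Primrec₂ prefixRun := by
    refine Primrec.ite ?_ ?_ (Primrec.const none)
    · exact Primrec.nat_le.comp Primrec.snd
        (Primrec.list_length.comp (Primrec.snd.comp (Primrec.fst.comp Primrec.fst)))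
    · refine Nat.Partrec.Code.primrec_evaln.comp (((Primrec.fst.comp
        (Primrec.unpair.comp Primrec.snd)).pair
          (Primrec.fst.comp (Primrec.fst.comp Primrec.fst))).pair ?_)
      refine Primrec.encode.comp (Primrec.pair ?_ (Primrec.snd.comp Primrec.fst))
      exact Primrec.list_take.comp (Primrec.snd.comp (Primrec.unpair.comp Primrec.snd))
        (Primrec.snd.comp (Primrec.fst.comp Primrec.fst))
  have h : Partrec fun x => Nat.rfindOpt (prefixRun x) := Partrec.rfindOpt key.to_comp
  have h' : REPred fun y : ((Nat.Partrec.Code × List ℕ) × ℕ) × ℕ =>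
      PrefixOutput y.1.1.1 y.1.1.2 y.1.2 y.2 := by
    have h1 := Partrec.comp h
      (Computable.fst : Computable (Prod.fst : ((Nat.Partrec.Code × List ℕ) × ℕ) × ℕ → _))
    exact Partrec.graph_re h1 Computable.snd
  exact REPred.comp (f := fun a => (((c a, w a), n a), v a)) h'
    (((hc.pair hw).pair hn).pair hv)

/-- The machine with program `c` outputs the sequence with initial segment `z` when it reads only
the finite part `w` of its oracle. -/
def PrefixOutputs (c : Nat.Partrec.Code) (w z : List ℕ) : Prop :=
  ∀ i ∈ List.range z.length, PrefixOutput c w i (z.getD i 0)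

theorem PrefixOutputs.re {α : Type*} [Primcodable α] (c : Nat.Partrec.Code) {w z : α → List ℕ}
    (hw : Computable w) (hz : Computable z) : REPred fun a => PrefixOutputs c (w a) (z a) := by
  refine REPred.forall_mem ?_ (Primrec.list_range.to_comp.comp (Computable.list_length.comp hz))
  exact PrefixOutput.re (Computable.const c) (hw.comp Computable.fst) Computable.snd
    ((Primrec.list_getD 0).to_comp.comp (hz.comp Computable.fst) Computable.snd)

theorem PrefixOutputs.eq_initSeg {c : Nat.Partrec.Code} {p r : ℕ → ℕ} {k : ℕ} {z : List ℕ}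
    (h : PrefixOutputs c (initSeg p k) z) (hr : Computes c p r) : z = initSeg r z.length :=
  eq_initSeg_of_getD fun i hi => (h i (List.mem_range.2 hi)).eq_of_computes hr

theorem Computes.exists_prefixOutputs {c : Nat.Partrec.Code} {p r : ℕ → ℕ} (h : Computes c p r)
    (l : ℕ) : ∃ k, ∀ j ≥ k, PrefixOutputs c (initSeg p j) (initSeg r l) := by
  choose k hk using fun i => mem_oracleEval_iff.1 (h i)
  refine ⟨(Finset.range l).sup k, fun j hj i hi => ?_⟩
  have hil : i < l := by simpa using hi
  rw [initSeg_getD r hil]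
  exact (hk i).mono ((Finset.le_sup (f := k) (Finset.mem_range.2 hil)).trans hj)

/-! ### Programs from computably enumerable conditions -/

/-- A machine can search for values that satisfy a computably enumerable condition on finite parts
of the oracle. -/
theorem exists_code_search {P : List ℕ → ℕ → ℕ → Prop}
    (hP : REPred fun x : (List ℕ × ℕ) × ℕ => P x.1.1 x.1.2 x.2) :
    ∃ c, ∀ p, (∀ n, ∃ k v, P (initSeg p k) n v) →
      ∃ r, Computes c p r ∧ ∀ n, ∃ k, P (initSeg p k) n (r n) := by
  obtain ⟨T, hT, -, eT⟩ := hP.exists_stages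
  -- `m` codes a prefix length, a candidate value and a stage. Since the prefix length is at most
  -- `m`, the guard ensures that `take` is never cut short.
  let step : List ℕ × ℕ → ℕ → Option ℕ := fun x m =>
    if m ≤ x.1.length then
      if T ((x.1.take m.unpair.1, x.2), m.unpair.2.unpair.1) m.unpair.2.unpair.2 = true then
        some m.unpair.2.unpair.1 else none
    else none
  have hstep : Primrec₂ step := by
    have hv : Primrec fun a : (List ℕ × ℕ) × ℕ => a.2.unpair.2.unpair.1 := Primrec.fst.comp
      (Primrec.unpair.comp (Primrec.snd.comp (Primrec.unpair.comp Primrec.snd)))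
    refine Primrec.ite ?_ (Primrec.ite ?_ ?_ (Primrec.const none)) (Primrec.const none)
    · exact Primrec.nat_le.comp Primrec.snd
        (Primrec.list_length.comp (Primrec.fst.comp Primrec.fst))
    · refine Primrec.eq.comp (hT.comp (Primrec.pair (Primrec.pair ?_ ?_) hv) ?_)
        (Primrec.const true)
      · exact Primrec.list_take.comp (Primrec.fst.comp (Primrec.unpair.comp Primrec.snd))
          (Primrec.fst.comp Primrec.fst)
      · exact Primrec.snd.comp Primrec.fst
      · exact Primrec.snd.comp
          (Primrec.unpair.comp (Primrec.snd.comp (Primrec.unpair.comp Primrec.snd)))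
    · exact Primrec.option_some.comp hv
  have hpart : Nat.Partrec fun a => Part.bind (Encodable.decode (α := List ℕ × ℕ) a)
      fun x => (Nat.rfindOpt (step x)).map Encodable.encode :=
    Partrec.rfindOpt hstep.to_comp
  obtain ⟨c, hc⟩ := Nat.Partrec.Code.exists_code.1 hpart
  have heval : ∀ (u : List ℕ) n, c.eval (Encodable.encode (u, n)) = Nat.rfindOpt (step (u, n)) := by
    intro u n
    rw [hc]
    simp only [Encodable.encodek, Part.coe_some, Part.bind_some]
    exact Part.map_id' (fun _ => rfl) _
  refine ⟨c, fun p hp => ?_⟩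
  let found : ℕ → ℕ → Prop := fun n m =>
    T ((initSeg p m.unpair.1, n), m.unpair.2.unpair.1) m.unpair.2.unpair.2 = true
  have hfound : ∀ n, ∃ m, found n m := by
    intro n
    obtain ⟨k, v, h⟩ := hp n
    obtain ⟨s, hs⟩ := (eT ((initSeg p k, n), v)).1 h
    exact ⟨Nat.pair k (Nat.pair v s), by simpa [found] using hs⟩
  -- The least successful `m` depends on `p` and `n` only. All prefixes on which the search succeeds
  -- therefore give the same answer, as `mem_oracleEval` requires.
  have hleast : ∀ n, ∃ m, found n m ∧ ∀ j < m, ¬ found n j := by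
    classical
    exact fun n => ⟨Nat.find (hfound n), Nat.find_spec (hfound n),
      fun j hj => Nat.find_min (hfound n) hj⟩
  choose M hM hMmin using hleast
  have hstepk : ∀ k n m, step (initSeg p k, n) m =
      if m ≤ k then if T ((initSeg p m.unpair.1, n), m.unpair.2.unpair.1) m.unpair.2.unpair.2 = true
        then some m.unpair.2.unpair.1 else none else none := by
    intro k n m
    simp only [step, initSeg_length]
    split_ifs with h1 h2 h3 h3
    · rfl
    · rw [initSeg_take _ ((Nat.unpair_left_le m).trans h1)] at h2
      exact absurd h2 h3
    · rw [initSeg_take _ ((Nat.unpair_left_le m).trans h1)] at h2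
      exact absurd h3 h2
    · rfl
    · rfl
  refine ⟨fun n => (M n).unpair.2.unpair.1, fun n => mem_oracleEval ?_ ?_, fun n => ?_⟩
  · intro k v hv
    change v ∈ c.eval (Encodable.encode (initSeg p k, n)) at hv
    rw [heval] at hv
    obtain ⟨m, hm, hj⟩ := Nat.mem_rfindOpt_iff.1 hv
    rw [hstepk] at hm
    split_ifs at hm with h1 h2
    have hmM : m = M n := by
      rcases lt_trichotomy m (M n) with h | h | h
      · exact absurd h2 (hMmin n m h)
      · exact h
      · have := hj _ h
        rw [hstepk, if_pos (by omega), if_pos (hM n)] at this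
        cases this
    subst hmM
    exact (Option.some.inj hm).symm
  · refine ⟨M n, ?_⟩
    change _ ∈ c.eval (Encodable.encode (initSeg p (M n), n))
    rw [heval]
    refine Nat.mem_rfindOpt_iff.2 ⟨M n, ?_, fun j hj => ?_⟩
    · rw [hstepk, if_pos le_rfl, if_pos (hM n)]
    · rw [hstepk, if_pos hj.le, if_neg (hMmin n j hj)]
  · exact ⟨(M n).unpair.1, (eT _).2 ⟨_, hM n⟩⟩

/-- A machine can enumerate a non-empty set that is computably enumerable in the oracle. -/
theorem exists_code_enumerate {Q : List ℕ → ℕ → Prop} (hQ : REPred fun x : List ℕ × ℕ => Q x.1 x.2) :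
    ∃ c, ∀ p, (∃ k v, Q (initSeg p k) v) →
      ∃ r, Computes c p r ∧ Set.range r = {v | ∃ k, Q (initSeg p k) v} := by
  obtain ⟨T, hT, -, eT⟩ := hQ.exists_stages
  -- Place `j` of the output codes a value, a prefix length and a stage. If these verify the value,
  -- it must be output at place `j`; otherwise any verified value may serve as filler. The condition
  -- `j ≤ w.length` makes the test independent of how long `w` is.
  let t : List ℕ → ℕ → Bool := fun w j =>
    T (w.take j.unpair.2.unpair.1, j.unpair.1) j.unpair.2.unpair.2
  let P : List ℕ → ℕ → ℕ → Prop := fun w j v =>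
    (∃ k, Q (w.take k) v) ∧ (decide (j ≤ w.length) && (!t w j || decide (v = j.unpair.1))) = true
  have hP : REPred fun x : (List ℕ × ℕ) × ℕ => P x.1.1 x.1.2 x.2 := by
    have hex : REPred fun x : (List ℕ × ℕ) × ℕ => ∃ k, Q (x.1.1.take k) x.2 := by
      have hf : Computable fun y : ((List ℕ × ℕ) × ℕ) × ℕ => (y.1.1.1.take y.2, y.1.2) :=
        (Primrec.list_take.to_comp.comp Computable.snd
          (Computable.fst.comp (Computable.fst.comp Computable.fst))).pair
          (Computable.snd.comp Computable.fst)
      have hQ' := REPred.comp hQ hf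
      exact REPred.exists hQ'
    refine hex.and (REPred.of_primrec ?_)
    · have hj : Primrec fun x : (List ℕ × ℕ) × ℕ => x.1.2 := Primrec.snd.comp Primrec.fst
      have hu : Primrec fun x : (List ℕ × ℕ) × ℕ => x.1.2.unpair := Primrec.unpair.comp hj
      have hu2 : Primrec fun x : (List ℕ × ℕ) × ℕ => x.1.2.unpair.2.unpair :=
        Primrec.unpair.comp (Primrec.snd.comp hu)
      refine Primrec.and.comp ?_ (Primrec.or.comp (Primrec.not.comp ?_) ?_)
      · exact Primrec.nat_le.decide.comp hj (Primrec.list_length.comp (Primrec.fst.comp Primrec.fst))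
      · exact hT.comp ((Primrec.list_take.comp (Primrec.fst.comp hu2)
          (Primrec.fst.comp Primrec.fst)).pair (Primrec.fst.comp hu)) (Primrec.snd.comp hu2)
      · exact (Primrec.eq (α := ℕ)).decide.comp Primrec.snd (Primrec.fst.comp hu)
  obtain ⟨c, hc⟩ := exists_code_search hP
  have hPp : ∀ p k j v, P (initSeg p k) j v ↔ (∃ i ≤ k, Q (initSeg p i) v) ∧ j ≤ k ∧
      (T (initSeg p j.unpair.2.unpair.1, j.unpair.1) j.unpair.2.unpair.2 = true →
        v = j.unpair.1) := by
    intro p k j v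
    simp only [P, t, Bool.and_eq_true, decide_eq_true_eq, initSeg_length, Bool.or_eq_true,
      Bool.not_eq_true']
    refine and_congr ?_ (and_congr_right fun hjk => ?_)
    · constructor
      · rintro ⟨i, hi⟩
        rcases le_total i k with h | h
        · exact ⟨i, h, by rwa [initSeg_take _ h] at hi⟩
        · rw [List.take_of_length_le (by simpa using h)] at hi
          exact ⟨k, le_rfl, hi⟩
      · rintro ⟨i, h, hi⟩
        exact ⟨i, by rwa [initSeg_take _ h]⟩
    · rw [initSeg_take]
      · cases T (initSeg p j.unpair.2.unpair.1, j.unpair.1) j.unpair.2.unpair.2 <;> simp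
      · exact (Nat.unpair_left_le _).trans ((Nat.unpair_right_le _).trans hjk)
  refine ⟨c, fun p hp => ?_⟩
  obtain ⟨k, v, hkv⟩ := hp
  have htot : ∀ j, ∃ k v, P (initSeg p k) j v := by
    intro j
    by_cases hT' : T (initSeg p j.unpair.2.unpair.1, j.unpair.1) j.unpair.2.unpair.2 = true
    · exact ⟨j, j.unpair.1, (hPp _ _ _ _).2 ⟨⟨j.unpair.2.unpair.1,
        (Nat.unpair_left_le _).trans (Nat.unpair_right_le _), (eT (_, _)).2 ⟨_, hT'⟩⟩,
        le_rfl, fun _ => rfl⟩⟩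
    · exact ⟨max k j, v, (hPp _ _ _ _).2 ⟨⟨k, le_max_left _ _, hkv⟩, le_max_right _ _,
        fun h => absurd h hT'⟩⟩
  obtain ⟨r, hr, hrP⟩ := hc p htot
  refine ⟨r, hr, Set.ext fun a => ⟨?_, ?_⟩⟩
  · rintro ⟨j, rfl⟩
    obtain ⟨k, hk⟩ := hrP j
    obtain ⟨⟨i, -, hi⟩, -⟩ := (hPp _ _ _ _).1 hk
    exact ⟨i, hi⟩
  · rintro ⟨k, hk⟩
    obtain ⟨s, hs⟩ := (eT (initSeg p k, a)).1 hk
    obtain ⟨l, hl⟩ := hrP (Nat.pair a (Nat.pair k s))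
    obtain ⟨-, -, h⟩ := (hPp _ _ _ _).1 hl
    refine ⟨_, (h ?_).trans (by simp)⟩
    simpa only [Nat.unpair_pair] using hs

/-- A machine can semidecide a computably enumerable condition on finite parts of the oracle. -/
theorem exists_code_semidecide {Q : List ℕ → Prop} (hQ : REPred Q) :
    ∃ c, ∀ p, ∃ r, Computes c p r ∧ (r ≠ 0 ↔ ∃ k, Q (initSeg p k)) := by
  obtain ⟨T, hT, -, eT⟩ := hQ.exists_stages
  let t : List ℕ → ℕ → ℕ := fun w n => bif T (w.take n.unpair.1) n.unpair.2 then 1 else 0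
  have ht : Primrec₂ t := by
    have hu : Primrec fun x : List ℕ × ℕ => x.2.unpair := Primrec.unpair.comp Primrec.snd
    exact Primrec.cond (hT.comp (Primrec.list_take.comp (Primrec.fst.comp hu) Primrec.fst)
      (Primrec.snd.comp hu)) (Primrec.const 1) (Primrec.const 0)
  -- Reading exactly `n` oracle values suffices for output place `n`, because `n.unpair.1 ≤ n`.
  have hP : REPred fun x : (List ℕ × ℕ) × ℕ => x.1.1.length = x.1.2 ∧ x.2 = t x.1.1 x.1.2 :=
    (REPred.eq (Computable.list_length.comp (Computable.fst.comp Computable.fst))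
      (Computable.snd.comp Computable.fst)).and
      (REPred.eq Computable.snd (ht.to_comp.comp (Computable.fst.comp Computable.fst)
        (Computable.snd.comp Computable.fst)))
  obtain ⟨c, hc⟩ := exists_code_search (P := fun w n v => w.length = n ∧ v = t w n) hP
  refine ⟨c, fun p => ?_⟩
  obtain ⟨r, hr, h⟩ := hc p fun n => ⟨n, _, initSeg_length p n, rfl⟩
  refine ⟨r, hr, ?_⟩
  have hrn : ∀ n, r n = bif T (initSeg p n.unpair.1) n.unpair.2 then 1 else 0 := by
    intro n
    obtain ⟨k, hk, hv⟩ := h n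
    rw [initSeg_length] at hk
    subst hk
    rw [hv]
    simp only [t]
    rw [initSeg_take _ (Nat.unpair_left_le k)]
  rw [Function.ne_iff]
  constructor
  · rintro ⟨n, hn⟩
    refine ⟨n.unpair.1, (eT _).2 ⟨n.unpair.2, ?_⟩⟩
    rw [hrn] at hn
    by_contra hT'
    rw [Bool.not_eq_true] at hT'
    rw [hT'] at hn
    exact hn rfl
  · rintro ⟨k, hk⟩
    obtain ⟨s, hs⟩ := (eT _).1 hk
    exact ⟨Nat.pair k s, by simp [hrn, hs]⟩

/-! ### Acceptance -/

/-- The machine with program `c` is seen to output a non-zero sequence when it reads only the finite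
part `w` of its oracle. -/
def Accepts (c : Nat.Partrec.Code) (w : List ℕ) : Prop :=
  ∃ n v, PrefixOutput c w n (v + 1)

theorem Accepts.re {α : Type*} [Primcodable α] {c : α → Nat.Partrec.Code} {w : α → List ℕ}
    (hc : Computable c) (hw : Computable w) : REPred fun a => Accepts (c a) (w a) := by
  have h : REPred fun x : (α × ℕ) × ℕ => PrefixOutput (c x.1.1) (w x.1.1) x.1.2 (x.2 + 1) :=
    PrefixOutput.re (hc.comp (Computable.fst.comp Computable.fst))
      (hw.comp (Computable.fst.comp Computable.fst)) (Computable.snd.comp Computable.fst)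
      (Computable.succ.comp Computable.snd)
  exact (h.exists (P := fun (x : α × ℕ) v => PrefixOutput (c x.1) (w x.1) x.2 (v + 1))).exists
    (P := fun a n => ∃ v, PrefixOutput (c a) (w a) n (v + 1))

theorem Computes.ne_zero_of_accepts {c : Nat.Partrec.Code} {p r : ℕ → ℕ} (h : Computes c p r)
    {k : ℕ} (hk : Accepts c (initSeg p k)) : r ≠ 0 := by
  obtain ⟨n, v, hv⟩ := hk
  refine Function.ne_iff.2 ⟨n, ?_⟩
  rw [← hv.eq_of_computes h]
  exact Nat.succ_ne_zero v

theorem Computes.exists_accepts {c : Nat.Partrec.Code} {p r : ℕ → ℕ} (h : Computes c p r)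
    (hr : r ≠ 0) : ∃ K, ∀ k ≥ K, Accepts c (initSeg p k) := by
  obtain ⟨n, hn⟩ := Function.ne_iff.1 hr
  obtain ⟨v, hv⟩ := Nat.exists_eq_succ_of_ne_zero hn
  obtain ⟨k, hk⟩ := mem_oracleEval_iff.1 (h n)
  rw [hv] at hk
  exact ⟨k, fun j hj => ⟨n, v, hk.mono hj⟩⟩

/-- The partial function on Baire space whose code has initial segment `u` is seen to output a
non-zero sequence when it reads only the finite part `w` of its argument. -/
def CodeAccepts (u w : List ℕ) : Prop :=
  decide (0 < u.length) = true ∧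
    Accepts (Denumerable.ofNat Nat.Partrec.Code (u.getD 0 0)) (interleave u.tail w)

theorem CodeAccepts.re {α : Type*} [Primcodable α] {u w : α → List ℕ}
    (hu : Primrec u) (hw : Primrec w) : REPred fun a => CodeAccepts (u a) (w a) := by
  have h1 : Primrec fun a => decide (0 < (u a).length) :=
    Primrec.nat_lt.decide.comp (Primrec.const 0) (Primrec.list_length.comp hu)
  have h2 : Computable fun a => Denumerable.ofNat Nat.Partrec.Code ((u a).getD 0 0) :=
    (Primrec.ofNat Nat.Partrec.Code).to_comp.comp (primrec_getD hu (Primrec.const 0)).to_comp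
  have h3 : Computable fun a => interleave (u a).tail (w a) :=
    (primrec_interleave (Primrec.list_tail.comp hu) hw).to_comp
  exact (REPred.of_primrec h1).and (Accepts.re h2 h3)

/-- The condition `0 < k` prevents the default value of `getD` from being mistaken for a program
index. The index takes up one entry, hence `k - 1`. -/
theorem codeAccepts_initSeg {p q : ℕ → ℕ} {k l : ℕ} :
    CodeAccepts (initSeg p k) (initSeg q l) ↔ 0 < k ∧
      Accepts (Denumerable.ofNat Nat.Partrec.Code (p 0))
        (initSeg (join (fun n => p (n + 1)) q) (2 * min (k - 1) l)) := by
  rw [CodeAccepts, initSeg_length, initSeg_tail, interleave_initSeg, decide_eq_true_eq]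
  refine and_congr_right fun hk => ?_
  rw [initSeg_getD p hk]

theorem CodeComputes.ne_zero_of_codeAccepts {p q r : ℕ → ℕ} (h : CodeComputes p q r) {k l : ℕ}
    (hkl : CodeAccepts (initSeg p k) (initSeg q l)) : r ≠ 0 :=
  Computes.ne_zero_of_accepts h (codeAccepts_initSeg.1 hkl).2

theorem CodeComputes.exists_codeAccepts {p q r : ℕ → ℕ} (h : CodeComputes p q r) (hr : r ≠ 0) :
    ∃ K, ∀ k ≥ K, ∀ l ≥ K, CodeAccepts (initSeg p k) (initSeg q l) := by
  obtain ⟨K, hK⟩ := Computes.exists_accepts h hr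
  exact ⟨K + 1, fun k hk l hl => codeAccepts_initSeg.2 ⟨by omega, hK _ (by omega)⟩⟩

/-- The code that consists of the index `e` of a program and the additional oracle `o`. -/
def codeName (e : ℕ) (o : ℕ → ℕ) (n : ℕ) : ℕ :=
  n.casesOn e o

theorem codeName_congr {e : ℕ} {o o' : ℕ → ℕ} {k : ℕ} (h : ∀ i < k, o i = o' i) :
    ∀ i < k, codeName e o i = codeName e o' i := by
  rintro (_ | i) hi
  · rfl
  · exact h i (by omega)

theorem primrec_codeName_const {α : Type*} [Primcodable α] (e : ℕ) {a : α → ℕ} (ha : Primrec a) :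
    Primrec₂ fun (x : α) (n : ℕ) => codeName e (fun _ => a x) n :=
  (Primrec.nat_casesOn Primrec.snd (Primrec.const e)
    (ha.comp (Primrec.fst.comp Primrec.fst)).to₂).of_eq fun x => by rcases x with ⟨x, _ | n⟩ <;> rfl

section RepresentedSpaces

variable {X Y Z : Type*}

/-! ### Names of open sets -/

/-- Points of the function space carry a continuity proof, and this provides it once a code is
known. Each output uses finitely many values of the join, hence finitely many of the argument. -/
theorem isContinuousMap_of_codeComputes {δX : BaireRepresentation X} {δY : BaireRepresentation Y}
    {f : X → Y} {p : ℕ → ℕ}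
    (hp : ∀ q x, δX.IsName q x → ∃ r, CodeComputes p q r ∧ δY.IsName r (f x)) :
    IsContinuousMap δX δY f := by
  classical
  let F : (ℕ → ℕ) → ℕ → ℕ := fun q => if h : ∃ r, CodeComputes p q r then h.choose else 0
  have hF : ∀ q r, CodeComputes p q r → F q = r := by
    intro q r hr
    have hex : ∃ r, CodeComputes p q r := ⟨r, hr⟩
    simp only [F, dif_pos hex]
    exact Computes.unique hex.choose_spec hr
  refine ⟨F, ?_, fun q x hq => ?_⟩
  · rintro q ⟨x, hq⟩
    refine continuousWithinAt_pi.2 fun n => ?_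
    obtain ⟨r, hr, -⟩ := hp q x hq
    obtain ⟨k, hk⟩ := oracleEval_use (hr n)
    have hnear : ∀ᶠ q' in nhds q, ∀ i ∈ Finset.range k, q' i = q i := by
      rw [Filter.eventually_all_finset]
      intro i _
      exact (continuous_apply (A := fun _ : ℕ => ℕ) i).continuousAt.eventually
        (p := fun m => m = q i) (IsOpen.mem_nhds (isOpen_discrete {q i}) rfl)
    have hev : ∀ᶠ q' in nhdsWithin q δX.dom, F q' n = F q n := by
      filter_upwards [nhdsWithin_le_nhds hnear, self_mem_nhdsWithin] with q' hq' hdom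
      obtain ⟨x', hx'⟩ := hdom
      obtain ⟨r', hr', -⟩ := hp q' x' hx'
      rw [hF q r hr, hF q' r' hr']
      refine Part.mem_unique (hr' n) (hk _ fun i hi => ?_)
      have : i / 2 ∈ Finset.range k := by
        rw [Finset.mem_range]; omega
      simp only [join, hq' _ this]
    exact (continuousWithinAt_const (b := F q n)).congr_of_eventuallyEq hev rfl
  · obtain ⟨r, hr, hrf⟩ := hp q x hq
    rw [hF q r hr]
    exact hrf

/-- Open sets that are given by a computably enumerable condition on the finite parts of an oracle
and of the names of points have names of the form `codeName e o` with a common index `e`. -/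
theorem exists_openName {Q : List ℕ → List ℕ → Prop}
    (hQ : REPred fun x : List ℕ × List ℕ => Q x.1 x.2) (δ : BaireRepresentation X) :
    ∃ e, ∀ o (U : X → Prop),
      (∀ q x, δ.IsName q x → (U x ↔ ∃ k, Q (initSeg o k) (initSeg q k))) →
        ∃ hU, (opensRep δ).IsName (codeName e o) ⟨U, hU⟩ := by
  have hQ' := REPred.comp hQ (primrec_evenPart.to_comp.pair primrec_oddPart.to_comp)
  obtain ⟨c, hc⟩ := exists_code_semidecide hQ'
  refine ⟨Encodable.encode c, fun o U hU => ?_⟩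
  have hname : ∀ q x, δ.IsName q x → ∃ r, CodeComputes (codeName (Encodable.encode c) o) q r ∧
      sierpinskiRep.IsName r (U x) := by
    intro q x hq
    obtain ⟨r, hr, hr0⟩ := hc (join o q)
    refine ⟨r, ?_, ?_⟩
    · change Computes (Denumerable.ofNat Nat.Partrec.Code (Encodable.encode c)) (join o q) r
      rwa [Denumerable.ofNat_encode]
    · change U x ↔ r ≠ 0
      rw [hU q x hq, hr0]
      simp only [evenPart_initSeg, oddPart_initSeg, join_even, join_odd]
      constructor
      · rintro ⟨k, hk⟩
        -- A prefix of the join of length `2 * k` splits into two prefixes of length `k`.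
        refine ⟨2 * k, ?_⟩
        rwa [Nat.mul_div_cancel_left _ Nat.two_pos]
      · rintro ⟨k, hk⟩
        exact ⟨_, hk⟩
  exact ⟨isContinuousMap_of_codeComputes hname, hname⟩

theorem mem_of_codeAccepts {δ : BaireRepresentation X} {U : OpenSets δ} {p q : ℕ → ℕ} {x : X}
    (hp : (opensRep δ).IsName p U) (hq : δ.IsName q x) {k l : ℕ}
    (h : CodeAccepts (initSeg p k) (initSeg q l)) : U.1 x := by
  obtain ⟨r, hr, hrU⟩ := hp q x hq
  exact hrU.2 (hr.ne_zero_of_codeAccepts h)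

theorem exists_codeAccepts_of_mem {δ : BaireRepresentation X} {U : OpenSets δ} {p q : ℕ → ℕ} {x : X}
    (hp : (opensRep δ).IsName p U) (hq : δ.IsName q x) (h : U.1 x) :
    ∃ K, ∀ k ≥ K, ∀ l ≥ K, CodeAccepts (initSeg p k) (initSeg q l) := by
  obtain ⟨r, hr, hrU⟩ := hp q x hq
  exact hr.exists_codeAccepts (hrU.1 h)

theorem mem_iff_codeAccepts {δ : BaireRepresentation X} {U : OpenSets δ} {p q : ℕ → ℕ} {x : X}
    (hp : (opensRep δ).IsName p U) (hq : δ.IsName q x) :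
    U.1 x ↔ ∃ k, CodeAccepts (initSeg p k) (initSeg q k) := by
  refine ⟨fun h => ?_, fun ⟨k, hk⟩ => mem_of_codeAccepts hp hq hk⟩
  obtain ⟨K, hK⟩ := exists_codeAccepts_of_mem hp hq h
  exact ⟨K, hK K le_rfl K le_rfl⟩

/-! ### Computable maps -/

/-- The composite searches for a finite prefix `z` of the intermediate sequence that suffices for
the second machine. -/
theorem exists_code_comp (c d : Nat.Partrec.Code) :
    ∃ e, ∀ p q r, Computes c p q → Computes d q r → Computes e p r := by
  have hf : REPred fun y : ((List ℕ × ℕ) × ℕ) × List ℕ =>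
      PrefixOutputs c y.1.1.1 y.2 ∧ PrefixOutput d y.2 y.1.1.2 y.1.2 := by
    refine REPred.and (PrefixOutputs.re c ?_ Computable.snd)
      (PrefixOutput.re (Computable.const d) Computable.snd ?_ ?_)
    · exact Computable.fst.comp (Computable.fst.comp Computable.fst)
    · exact Computable.snd.comp (Computable.fst.comp Computable.fst)
    · exact Computable.snd.comp Computable.fst
  obtain ⟨e, he⟩ := exists_code_search
    (P := fun w n v => ∃ z, PrefixOutputs c w z ∧ PrefixOutput d z n v) (REPred.exists hf)
  refine ⟨e, fun p q r hq hr => ?_⟩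
  have htot : ∀ n, ∃ k v z, PrefixOutputs c (initSeg p k) z ∧ PrefixOutput d z n v := by
    intro n
    obtain ⟨l, hl⟩ := mem_oracleEval_iff.1 (hr n)
    obtain ⟨k, hk⟩ := hq.exists_prefixOutputs l
    exact ⟨k, r n, _, hk k le_rfl, hl⟩
  obtain ⟨r', hr', h⟩ := he p htot
  have : r' = r := by
    funext n
    obtain ⟨k, z, hz, hv⟩ := h n
    rw [hz.eq_initSeg hq] at hv
    exact hv.eq_of_computes hr
  rwa [← this]

theorem IsComputableMap.comp {δX : BaireRepresentation X} {δY : BaireRepresentation Y}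
    {δZ : BaireRepresentation Z} {g : Y → Z} {f : X → Y} (hg : IsComputableMap δY δZ g)
    (hf : IsComputableMap δX δY f) : IsComputableMap δX δZ (g ∘ f) := by
  obtain ⟨d, hd⟩ := hg
  obtain ⟨c, hc⟩ := hf
  obtain ⟨e, he⟩ := exists_code_comp c d
  refine ⟨e, fun p x hp => ?_⟩
  obtain ⟨q, hq, hqf⟩ := hc p x hp
  obtain ⟨r, hr, hrg⟩ := hd q _ hqf
  exact ⟨r, he p q r hq hr, hrg⟩

theorem IsComputablyIsomorphic.trans {δX : BaireRepresentation X} {δY : BaireRepresentation Y}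
    {δZ : BaireRepresentation Z} (h : IsComputablyIsomorphic δX δY)
    (h' : IsComputablyIsomorphic δY δZ) : IsComputablyIsomorphic δX δZ := by
  obtain ⟨e, he, he'⟩ := h
  obtain ⟨f, hf, hf'⟩ := h'
  exact ⟨e.trans f, hf.comp he, he'.comp hf'⟩

/-! ### Discrete spaces -/

/-- An accepting run of the equality test sees only finite parts of the two names. Soundness applies
to all names with these prefixes, so a positive answer carries over to other names that share them.
-/
theorem IsComputablyDiscrete.exists_re {δ : BaireRepresentation X} (h : IsComputablyDiscrete δ) :
    ∃ E : List ℕ → List ℕ → Prop, REPred (fun x : List ℕ × List ℕ => E x.1 x.2) ∧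
      (∀ p q x y, δ.IsName p x → δ.IsName q y → ∀ k l, E (initSeg p k) (initSeg q l) → x = y) ∧
      ∀ p q x, δ.IsName p x → δ.IsName q x →
        ∃ K, ∀ k ≥ K, ∀ l ≥ K, E (initSeg p k) (initSeg q l) := by
  obtain ⟨c, hc⟩ := h
  have hjoin : ∀ p q x y, δ.IsName p x → δ.IsName q y → ∃ r, Computes c (join p q) r ∧
      (x = y ↔ r ≠ 0) := by
    intro p q x y hp hq
    obtain ⟨r, hr, hr0⟩ := hc (join p q) (x, y)
      ⟨by simpa only [join_even] using hp, by simpa only [join_odd] using hq⟩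
    exact ⟨r, hr, hr0⟩
  refine ⟨fun u w => Accepts c (interleave u w), Accepts.re (Computable.const c)
    (primrec_interleave Primrec.fst Primrec.snd).to_comp, ?_, ?_⟩
  · intro p q x y hp hq k l hkl
    obtain ⟨r, hr, hr0⟩ := hjoin p q x y hp hq
    rw [interleave_initSeg] at hkl
    exact hr0.2 (hr.ne_zero_of_accepts hkl)
  · intro p q x hp hq
    obtain ⟨r, hr, hr0⟩ := hjoin p q x x hp hq
    obtain ⟨K, hK⟩ := hr.exists_accepts (hr0.1 rfl)
    refine ⟨K, fun k hk l hl => ?_⟩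
    change Accepts c (interleave _ _)
    rw [interleave_initSeg]
    exact hK _ (by omega)

theorem isComputablyDiscrete_of_re {δ : BaireRepresentation X} {E : List ℕ → List ℕ → Prop}
    (hE : REPred fun x : List ℕ × List ℕ => E x.1 x.2)
    (h : ∀ p q x y, δ.IsName p x → δ.IsName q y →
      (x = y ↔ ∃ k, E (initSeg p k) (initSeg q k))) : IsComputablyDiscrete δ := by
  have hE' := REPred.comp hE (primrec_evenPart.to_comp.pair primrec_oddPart.to_comp)
  obtain ⟨c, hc⟩ := exists_code_semidecide hE'
  refine ⟨c, fun p z hz => ?_⟩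
  obtain ⟨r, hr, hr0⟩ := hc p
  refine ⟨r, hr, ?_⟩
  change z.1 = z.2 ↔ r ≠ 0
  rw [h _ _ _ _ hz.1 hz.2, hr0]
  simp only [evenPart_initSeg, oddPart_initSeg]
  constructor
  · rintro ⟨k, hk⟩
    refine ⟨2 * k, ?_⟩
    rwa [Nat.mul_div_cancel_left _ Nat.two_pos]
  · rintro ⟨k, hk⟩
    exact ⟨_, hk⟩

/-- Equality of points is tested on their images, after enough of the names of the images has been
computed. -/
theorem IsComputablyDiscrete.of_injective {δX : BaireRepresentation X} {δY : BaireRepresentation Y}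
    (h : IsComputablyDiscrete δY) {f : X → Y} (hf : IsComputableMap δX δY f)
    (hinj : Function.Injective f) : IsComputablyDiscrete δX := by
  obtain ⟨E, hE, hsound, hcomplete⟩ := h.exists_re
  obtain ⟨c, hc⟩ := hf
  have h1 : REPred fun y : ((List ℕ × List ℕ) × List ℕ) × List ℕ =>
      PrefixOutputs c y.1.1.1 y.1.2 ∧ PrefixOutputs c y.1.1.2 y.2 ∧ E y.1.2 y.2 := by
    have hE' := REPred.comp hE ((Computable.snd.comp (Computable.fst
      (α := (List ℕ × List ℕ) × List ℕ))).pair (Computable.snd (β := List ℕ)))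
    refine REPred.and (PrefixOutputs.re c ?_ (Computable.snd.comp Computable.fst))
      (REPred.and (PrefixOutputs.re c ?_ Computable.snd) hE')
    · exact Computable.fst.comp (Computable.fst.comp Computable.fst)
    · exact Computable.snd.comp (Computable.fst.comp Computable.fst)
  refine isComputablyDiscrete_of_re (E := fun u w => ∃ u' w', PrefixOutputs c u u' ∧
    PrefixOutputs c w w' ∧ E u' w') (REPred.exists (REPred.exists h1)) ?_
  intro p q x y hp hq
  obtain ⟨p', hp', hpx⟩ := hc p x hp
  obtain ⟨q', hq', hqy⟩ := hc q y hq
  constructor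
  · rintro rfl
    obtain ⟨K, hK⟩ := hcomplete p' q' _ hpx hqy
    obtain ⟨k, hk⟩ := hp'.exists_prefixOutputs K
    obtain ⟨l, hl⟩ := hq'.exists_prefixOutputs K
    exact ⟨max k l, _, _, hk _ (le_max_left _ _), hl _ (le_max_right _ _), hK K le_rfl K le_rfl⟩
  · rintro ⟨k, u', w', hu', hw', hE'⟩
    rw [hu'.eq_initSeg hp', hw'.eq_initSeg hq'] at hE'
    exact hinj (hsound _ _ _ _ hpx hqy _ _ hE')

/-- A non-empty computably enumerable set is the range of a computable function. -/
theorem REPred.exists_enumeration {β : Type*} [Primcodable β] {P : β → Prop} (hP : REPred P)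
    {b : β} (hb : P b) : ∃ g : ℕ → β, Computable g ∧ (∀ n, P (g n)) ∧ ∀ a, P a → ∃ n, g n = a := by
  obtain ⟨T, hT, -, eT⟩ := hP.exists_stages
  refine ⟨fun n => ((Encodable.decode (α := β) n.unpair.1).map fun a =>
    bif T a n.unpair.2 then a else b).getD b, ?_, ?_, ?_⟩
  · refine Primrec.to_comp ?_
    refine Primrec.option_getD.comp (Primrec.option_map ?_ ?_) (Primrec.const b)
    · exact Primrec.decode.comp (Primrec.fst.comp Primrec.unpair)
    · exact Primrec.cond (hT.comp Primrec.snd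
        (Primrec.snd.comp (Primrec.unpair.comp Primrec.fst))) Primrec.snd (Primrec.const b)
  · intro n
    dsimp only
    rcases Encodable.decode (α := β) n.unpair.1 with _ | a
    · exact hb
    · rcases h : T a n.unpair.2
      · simpa [h] using hb
      · simpa [h] using (eT a).2 ⟨_, h⟩
  · intro a ha
    obtain ⟨s, hs⟩ := (eT a).1 ha
    exact ⟨Nat.pair (Encodable.encode a) s, by simp [hs]⟩

theorem REPred.getElem?_eq_some {α : Type*} [Primcodable α] {w : α → List ℕ} {i v : α → ℕ}
    (hw : Computable w) (hi : Computable i) (hv : Computable v) :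
    REPred fun a => (w a)[i a]? = some (v a) :=
  REPred.eq (Computable.list_getElem?.comp hw hi) (Computable.option_some.comp hv)

theorem exists_code_id : ∃ c, ∀ p, Computes c p p := by
  obtain ⟨c, hc⟩ := exists_code_search (P := fun w n v => w[n]? = some v)
    (REPred.getElem?_eq_some (Computable.fst.comp Computable.fst)
      (Computable.snd.comp Computable.fst) Computable.snd)
  refine ⟨c, fun p => ?_⟩
  obtain ⟨r, hr, h⟩ := hc p fun n => ⟨n + 1, p n, initSeg_getElem? p (Nat.lt_succ_self n)⟩
  have : p = r := funext fun n => by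
    obtain ⟨k, hk⟩ := h n
    exact eq_of_initSeg_getElem? hk
  rwa [← this] at hr

theorem exists_code_nat {g : ℕ → ℕ → ℕ} (hg : Computable₂ g) :
    ∃ c, ∀ p, Computes c p (g (p 0)) := by
  have h : REPred fun y : ((List ℕ × ℕ) × ℕ) × ℕ => y.1.1.1[0]? = some y.2 ∧
      y.1.2 = g y.2 y.1.1.2 := by
    refine REPred.and (REPred.getElem?_eq_some ?_ (Computable.const 0) Computable.snd)
      (REPred.eq (Computable.snd.comp Computable.fst) (hg.comp Computable.snd ?_))
    · exact Computable.fst.comp (Computable.fst.comp Computable.fst)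
    · exact Computable.snd.comp (Computable.fst.comp Computable.fst)
  obtain ⟨c, hc⟩ := exists_code_search (P := fun w n v => ∃ a, w[0]? = some a ∧ v = g a n)
    (REPred.exists h)
  refine ⟨c, fun p => ?_⟩
  obtain ⟨r, hr, h⟩ := hc p fun n => ⟨1, _, p 0, initSeg_getElem? p Nat.one_pos, rfl⟩
  have : r = g (p 0) := funext fun n => by
    obtain ⟨k, a, ha, hv⟩ := h n
    rw [eq_of_initSeg_getElem? ha, hv]
  rwa [← this]

theorem primrec_initSeg_const {α : Type*} [Primcodable α] {n k : α → ℕ} (hn : Primrec n)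
    (hk : Primrec k) : Primrec fun a => initSeg (fun _ => n a) (k a) :=
  primrec_initSeg (hn.comp Primrec.fst) hk

theorem primrec_initSeg_codeName_const {α : Type*} [Primcodable α] (e : ℕ) {n k : α → ℕ}
    (hn : Primrec n) (hk : Primrec k) :
    Primrec fun a => initSeg (codeName e fun _ => n a) (k a) :=
  primrec_initSeg (primrec_codeName_const e hn) hk

/-! ### Spaces with a computable surjection from the natural numbers -/

/-- A non-empty open set contains some `s n`, and a search over `n` and finite runs finds it. -/
theorem isComputablyOvert_of_surjective {δ : BaireRepresentation X} {s : ℕ → X}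
    (hs : IsComputableMap natRep δ s) (hsurj : Function.Surjective s) : IsComputablyOvert δ := by
  obtain ⟨c, hc⟩ := hs
  have h : REPred fun y : ((List ℕ × ℕ) × ℕ) × List ℕ =>
      PrefixOutputs c (initSeg (fun _ => y.1.1.2) y.1.2) y.2 ∧ CodeAccepts y.1.1.1 y.2 := by
    refine REPred.and (PrefixOutputs.re c (primrec_initSeg_const ?_ ?_).to_comp Computable.snd)
      (CodeAccepts.re ?_ Primrec.snd)
    · exact Primrec.snd.comp (Primrec.fst.comp Primrec.fst)
    · exact Primrec.snd.comp Primrec.fst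
    · exact Primrec.fst.comp (Primrec.fst.comp Primrec.fst)
  obtain ⟨d, hd⟩ := exists_code_semidecide (Q := fun u => ∃ n l z,
    PrefixOutputs c (initSeg (fun _ => n) l) z ∧ CodeAccepts u z)
    (REPred.exists (REPred.exists (REPred.exists h)))
  refine ⟨d, fun p U hp => ?_⟩
  obtain ⟨r, hr, hr0⟩ := hd p
  refine ⟨r, hr, ?_⟩
  change (∃ x, U.1 x) ↔ r ≠ 0
  rw [hr0]
  constructor
  · rintro ⟨x, hx⟩
    obtain ⟨n, rfl⟩ := hsurj x
    obtain ⟨q, hq, hqs⟩ := hc (fun _ => n) n rfl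
    obtain ⟨k, hk⟩ := (mem_iff_codeAccepts hp hqs).1 hx
    obtain ⟨l, hl⟩ := hq.exists_prefixOutputs k
    exact ⟨k, n, l, _, hl l le_rfl, hk⟩
  · rintro ⟨k, n, l, z, hz, hacc⟩
    obtain ⟨q, hq, hqs⟩ := hc (fun _ => n) n rfl
    rw [hz.eq_initSeg hq] at hacc
    exact ⟨s n, mem_of_codeAccepts hp hqs hacc⟩

/-- In a discrete space, a machine can find preimages under a computable sequence. -/
theorem IsComputablyDiscrete.exists_code_preimage {δ : BaireRepresentation X}
    (hδ : IsComputablyDiscrete δ) {s : ℕ → X} (hs : IsComputableMap natRep δ s) :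
    ∃ d, ∀ p x, δ.IsName p x → x ∈ Set.range s → ∃ r, Computes d p r ∧ s (r 0) = x := by
  obtain ⟨E, hE, hsound, hcomplete⟩ := hδ.exists_re
  obtain ⟨c, hc⟩ := hs
  have h : REPred fun y : (((List ℕ × ℕ) × ℕ) × ℕ) × List ℕ =>
      PrefixOutputs c (initSeg (fun _ => y.1.1.2) y.1.2) y.2 ∧ E y.1.1.1.1 y.2 := by
    have hf : Computable fun y : (((List ℕ × ℕ) × ℕ) × ℕ) × List ℕ => (y.1.1.1.1, y.2) :=
      (Computable.fst.comp (Computable.fst.comp (Computable.fst.comp Computable.fst))).pair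
        Computable.snd
    have hE' := REPred.comp hE hf
    refine REPred.and (PrefixOutputs.re c (primrec_initSeg_const ?_ ?_).to_comp Computable.snd) hE'
    · exact Primrec.snd.comp (Primrec.fst.comp Primrec.fst)
    · exact Primrec.snd.comp Primrec.fst
  -- The condition ignores the output place, so different places may hold different preimages. Only
  -- the entry at place `0` matters.
  obtain ⟨d, hd⟩ := exists_code_search (P := fun w _ n => ∃ l z,
    PrefixOutputs c (initSeg (fun _ => n) l) z ∧ E w z) (REPred.exists (REPred.exists h))
  refine ⟨d, ?_⟩
  rintro p _ hp ⟨n, rfl⟩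
  obtain ⟨r, hr, h⟩ := hd p fun j => by
    obtain ⟨q, hq, hqs⟩ := hc (fun _ => n) n rfl
    obtain ⟨K, hK⟩ := hcomplete p q _ hp hqs
    obtain ⟨l, hl⟩ := hq.exists_prefixOutputs K
    exact ⟨K, n, l, _, hl l le_rfl, hK K le_rfl K le_rfl⟩
  obtain ⟨k, l, z, hz, hkz⟩ := h 0
  obtain ⟨q, hq, hqs⟩ := hc (fun _ => r 0) (r 0) rfl
  rw [hz.eq_initSeg hq] at hkz
  exact ⟨r, hr, (hsound _ _ _ _ hp hqs _ _ hkz).symm⟩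

/-- The new names of `x` are the sequences `p` with `s (p 0) = x`. Discreteness is needed to
translate old names into new ones, by finding a preimage. -/
theorem exists_total_of_surjective {δ : BaireRepresentation X} (hδ : IsComputablyDiscrete δ)
    {s : ℕ → X} (hs : IsComputableMap natRep δ s) (hsurj : Function.Surjective s) :
    ∃ δ' : BaireRepresentation X, δ'.dom = Set.univ ∧ IsComputablyEquivalent δ δ' := by
  refine ⟨⟨fun p x => s (p 0) = x, fun h h' => h.symm.trans h', fun x => ?_⟩, ?_, ?_, ?_⟩
  · obtain ⟨n, hn⟩ := hsurj x
    exact ⟨fun _ => n, hn⟩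
  · exact Set.eq_univ_of_forall fun p => ⟨s (p 0), rfl⟩
  · obtain ⟨d, hd⟩ := hδ.exists_code_preimage hs
    exact ⟨d, fun p x hp => hd p x hp (hsurj x)⟩
  · obtain ⟨c, hc⟩ := hs
    refine ⟨c, ?_⟩
    rintro p _ rfl
    exact hc p (p 0) rfl

theorem exists_surjective_of_total {δ δ' : BaireRepresentation X} (hδ : IsComputablyDiscrete δ)
    (htot : δ'.dom = Set.univ) (heq : IsComputablyEquivalent δ δ') :
    ∃ s : ℕ → X, IsComputableMap natRep δ s ∧ Function.Surjective s := by
  -- `g n` is the list coded by `n`, padded with zeros. By totality it names some point.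
  let g : ℕ → ℕ → ℕ := fun n j => (Denumerable.ofNat (List ℕ) n).getD j 0
  have hg : Primrec₂ g :=
    primrec_getD ((Primrec.ofNat (List ℕ)).comp Primrec.fst) Primrec.snd
  have hdom : ∀ n, ∃ x, δ'.IsName (g n) x := fun n => (Set.ext_iff.1 htot (g n)).2 trivial
  choose s hs using hdom
  obtain ⟨c, hc⟩ := exists_code_nat hg.to_comp
  have hsδ' : IsComputableMap natRep δ' s := by
    refine ⟨c, ?_⟩
    rintro p _ rfl
    exact ⟨_, hc p, hs (p 0)⟩
  refine ⟨s, heq.2.comp hsδ', fun x => ?_⟩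
  obtain ⟨E, -, hsound, hcomplete⟩ := (hδ.of_injective heq.2 Function.injective_id).exists_re
  obtain ⟨p, hp⟩ := δ'.surjective x
  obtain ⟨K, hK⟩ := hcomplete p p x hp hp
  -- The test of `p` against itself has accepted after `K` entries, so it also accepts `p` against
  -- its truncation.
  refine ⟨Encodable.encode (initSeg p K), hsound _ _ _ _ (hs _) hp K K ?_⟩
  have : initSeg (g (Encodable.encode (initSeg p K))) K = initSeg p K := by
    refine initSeg_congr fun i hi => ?_
    simp only [g, Denumerable.ofNat_encode]
    exact initSeg_getD p hi
  rw [this]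
  exact hK K le_rfl K le_rfl

/-! ### Quotients of the natural numbers -/

theorem natQuotientRep_isName_iff {R : Setoid ℕ} {p : ℕ → ℕ} {z : Quotient R} :
    (natQuotientRep R).IsName p z ↔ Quotient.mk R (p 0) = z :=
  ⟨fun ⟨_, hn, h⟩ => hn ▸ h, fun h => ⟨p 0, rfl, h⟩⟩

theorem natQuotientRep_isName_const (R : Setoid ℕ) (n : ℕ) :
    (natQuotientRep R).IsName (fun _ => n) (Quotient.mk R n) :=
  ⟨n, rfl, rfl⟩

/-- Run the equality test of the quotient on the constant names of `n` and `m`. -/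
theorem isCeer_of_isComputablyDiscrete {R : Setoid ℕ}
    (h : IsComputablyDiscrete (natQuotientRep R)) : IsCeer R := by
  obtain ⟨E, hE, hsound, hcomplete⟩ := h.exists_re
  have hf : Primrec fun y : (ℕ × ℕ) × ℕ =>
      (initSeg (fun _ => y.1.1) y.2, initSeg (fun _ => y.1.2) y.2) :=
    (primrec_initSeg_const (Primrec.fst.comp Primrec.fst) Primrec.snd).pair
      (primrec_initSeg_const (Primrec.snd.comp Primrec.fst) Primrec.snd)
  have hE' := REPred.comp hE hf.to_comp
  refine (REPred.exists (P := fun (x : ℕ × ℕ) k =>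
    E (initSeg (fun _ => x.1) k) (initSeg (fun _ => x.2) k)) hE').of_eq ?_
  rintro ⟨n, m⟩
  constructor
  · rintro ⟨k, hk⟩
    exact Quotient.exact (hsound _ _ _ _ (natQuotientRep_isName_const R n)
      (natQuotientRep_isName_const R m) _ _ hk)
  · intro hnm
    obtain ⟨K, hK⟩ := hcomplete (fun _ => n) (fun _ => m) (Quotient.mk R n)
      (natQuotientRep_isName_const R n)
      ((Quotient.sound hnm : Quotient.mk R n = Quotient.mk R m) ▸ natQuotientRep_isName_const R m)
    exact ⟨K, hK K le_rfl K le_rfl⟩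

/-- The heads of two lists are defined and related. -/
def HeadsRelated (R : Setoid ℕ) (u w : List ℕ) : Prop :=
  ∃ n m, u[0]? = some n ∧ w[0]? = some m ∧ R n m

theorem IsCeer.headsRelated_re {R : Setoid ℕ} (hR : IsCeer R) :
    REPred fun x : List ℕ × List ℕ => HeadsRelated R x.1 x.2 := by
  have h : REPred fun y : ((List ℕ × List ℕ) × ℕ) × ℕ =>
      y.1.1.1[0]? = some y.1.2 ∧ y.1.1.2[0]? = some y.2 ∧ R y.1.2 y.2 := by
    have hf : Computable fun y : ((List ℕ × List ℕ) × ℕ) × ℕ => (y.1.2, y.2) :=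
      (Computable.snd.comp Computable.fst).pair Computable.snd
    have hR' := REPred.comp hR hf
    refine REPred.and (REPred.getElem?_eq_some ?_ (Computable.const 0) ?_)
      (REPred.and (REPred.getElem?_eq_some ?_ (Computable.const 0) Computable.snd) hR')
    · exact Computable.fst.comp (Computable.fst.comp Computable.fst)
    · exact Computable.snd.comp Computable.fst
    · exact Computable.snd.comp (Computable.fst.comp Computable.fst)
  exact REPred.exists (REPred.exists h)

theorem exists_headsRelated_iff {R : Setoid ℕ} {p q : ℕ → ℕ} :
    (∃ k, HeadsRelated R (initSeg p k) (initSeg q k)) ↔ R (p 0) (q 0) := by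
  constructor
  · rintro ⟨k, n, m, hn, hm, hnm⟩
    rwa [eq_of_initSeg_getElem? hn, eq_of_initSeg_getElem? hm]
  · exact fun h => ⟨1, _, _, initSeg_getElem? p Nat.one_pos, initSeg_getElem? q Nat.one_pos, h⟩

theorem IsCeer.isComputablyDiscrete {R : Setoid ℕ} (hR : IsCeer R) :
    IsComputablyDiscrete (natQuotientRep R) := by
  refine isComputablyDiscrete_of_re hR.headsRelated_re fun p q x y hp hq => ?_
  rw [exists_headsRelated_iff, ← natQuotientRep_isName_iff.1 hp, ← natQuotientRep_isName_iff.1 hq]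
  exact Quotient.eq

/-- A discrete space with a computable surjection from the natural numbers is a discrete quotient of
the natural numbers. -/
theorem exists_quotient_of_surjective {δ : BaireRepresentation X} (hδ : IsComputablyDiscrete δ)
    {s : ℕ → X} (hs : IsComputableMap natRep δ s) (hsurj : Function.Surjective s) :
    ∃ R : Setoid ℕ, IsComputablyDiscrete (natQuotientRep R) ∧
      IsComputablyIsomorphic δ (natQuotientRep R) := by
  let e : Quotient (Setoid.ker s) ≃ X := Setoid.quotientKerEquivOfSurjective s hsurj
  have he : ∀ n, e (Quotient.mk _ n) = s n := fun n => rfl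
  have hcomp : IsComputableMap (natQuotientRep (Setoid.ker s)) δ e := by
    obtain ⟨c, hc⟩ := hs
    refine ⟨c, ?_⟩
    rintro p _ ⟨n, hn, rfl⟩
    exact hc p n hn
  refine ⟨Setoid.ker s, hδ.of_injective hcomp e.injective, e.symm, ?_, hcomp⟩
  obtain ⟨d, hd⟩ := hδ.exists_code_preimage hs
  refine ⟨d, fun p x hp => ?_⟩
  obtain ⟨r, hr, hrx⟩ := hd p x hp (hsurj x)
  refine ⟨r, hr, natQuotientRep_isName_iff.2 ?_⟩
  rw [Equiv.eq_symm_apply, he, hrx]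

theorem exists_surjective_of_isomorphic {δ : BaireRepresentation X} {R : Setoid ℕ}
    (h : IsComputablyIsomorphic δ (natQuotientRep R)) :
    ∃ s : ℕ → X, IsComputableMap natRep δ s ∧ Function.Surjective s := by
  obtain ⟨e, -, c, hc⟩ := h
  refine ⟨fun n => e.symm (Quotient.mk R n), ⟨c, fun p n hp => hc p _ ⟨n, hp, rfl⟩⟩, ?_⟩
  exact e.symm.surjective.comp Quotient.mk_surjective

/-- The quotient by a ceer is the space of ideals of this relation. -/
theorem IsCeer.isComputablyIsomorphic_idealRep {R : Setoid ℕ} (hR : IsCeer R) :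
    IsComputablyIsomorphic (natQuotientRep R) (idealRep fun n m => R n m) := by
  let cls : ℕ → RelIdeal fun n m => R n m := fun n =>
    ⟨{m | R n m}, ⟨n, R.refl n⟩, fun x y hy hxy => R.trans hy (R.symm hxy),
      fun x hx y hy => ⟨n, R.refl n, R.symm hx, R.symm hy⟩⟩
  have hcls : ∀ {n m}, R n m → cls n = cls m := by
    intro n m h
    have : {k | R n k} = {k | R m k} :=
      Set.ext fun k => ⟨fun hk => R.trans (R.symm h) hk, fun hk => R.trans h hk⟩
    simp only [cls, this]
  let f : Quotient R → RelIdeal fun n m => R n m := Quotient.lift cls fun _ _ h => hcls h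
  -- Downward closure and symmetry put the class of `n` inside the ideal; directedness gives the
  -- other inclusion.
  have hf : ∀ (I : RelIdeal fun n m => R n m) n, n ∈ I.carrier → f (Quotient.mk R n) = I := by
    rintro ⟨A, hne, hdown, hdir⟩ n hn
    have : {m | R n m} = A := by
      refine Set.ext fun m => ⟨fun hm => hdown m n hn (R.symm hm), fun hm => ?_⟩
      obtain ⟨z, -, hz, hz'⟩ := hdir n hn m hm
      exact R.trans hz (R.symm hz')
    change cls n = _
    simp only [cls, this]
  have hbij : Function.Bijective f := by
    constructor
    · intro x y
      induction x using Quotient.inductionOn with | h n =>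
      induction y using Quotient.inductionOn with | h m =>
      intro h
      have h' : (cls n).carrier = (cls m).carrier := congrArg RelIdeal.carrier h
      have hm : m ∈ (cls n).carrier := h' ▸ (R.refl m : m ∈ (cls m).carrier)
      exact Quotient.sound hm
    · intro I
      obtain ⟨n, hn⟩ := I.nonempty
      exact ⟨_, hf I n hn⟩
  refine ⟨Equiv.ofBijective f hbij, ?_, ?_⟩
  · have h : REPred fun y : (List ℕ × ℕ) × ℕ => y.1.1[0]? = some y.2 ∧ R y.2 y.1.2 := by
      have hg : Computable fun y : (List ℕ × ℕ) × ℕ => (y.2, y.1.2) :=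
        Computable.snd.pair (Computable.snd.comp Computable.fst)
      have hR' := REPred.comp hR hg
      exact REPred.and (REPred.getElem?_eq_some (Computable.fst.comp Computable.fst)
        (Computable.const 0) Computable.snd) hR'
    obtain ⟨c, hc⟩ := exists_code_enumerate (Q := fun w m => ∃ n, w[0]? = some n ∧ R n m)
      (REPred.exists h)
    refine ⟨c, fun p x hp => ?_⟩
    obtain ⟨r, hr, hrange⟩ := hc p ⟨1, p 0, p 0, initSeg_getElem? p Nat.one_pos, R.refl _⟩
    refine ⟨r, hr, ?_⟩
    rw [← natQuotientRep_isName_iff.1 hp]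
    change {m | R (p 0) m} = Set.range r
    rw [hrange]
    refine Set.ext fun m => ⟨fun hm => ⟨1, p 0, initSeg_getElem? p Nat.one_pos, hm⟩, ?_⟩
    rintro ⟨k, n, hn, hm⟩
    rwa [← eq_of_initSeg_getElem? hn] at hm
  -- The identity realises the inverse: the first entry of an enumeration of a class is a
  -- representative.
  · obtain ⟨c, hc⟩ := exists_code_id
    refine ⟨c, fun p I hp => ⟨p, hc p, natQuotientRep_isName_iff.2 ?_⟩⟩
    rw [Equiv.eq_symm_apply]
    refine hf I (p 0) ?_
    have hp' : I.carrier = Set.range p := hp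
    rw [hp']
    exact ⟨0, rfl⟩

theorem isComputablyQuasiPolish_of_isCeer {δ : BaireRepresentation X} {R : Setoid ℕ}
    (hR : IsCeer R) (h : IsComputablyIsomorphic δ (natQuotientRep R)) :
    IsComputablyQuasiPolish δ := by
  obtain ⟨s, hs, hsurj⟩ := exists_surjective_of_isomorphic h
  exact ⟨⟨fun n m => R n m, fun _ _ _ => R.trans, hR,
    h.trans hR.isComputablyIsomorphic_idealRep⟩, isComputablyOvert_of_surjective hs hsurj⟩

/-! ### Discrete quasi-Polish spaces -/

/-- Semideciding whether a finite set can be extended to a point of an overt space of ideals. -/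
theorem exists_re_extendible {δ : BaireRepresentation X} (hover : IsComputablyOvert δ)
    {ll : ℕ → ℕ → Prop} {e : X → RelIdeal ll} (he : IsComputableMap δ (idealRep ll) e) :
    REPred fun w : List ℕ => ∃ x, ∀ a ∈ w, a ∈ (e x).carrier := by
  obtain ⟨c, hc⟩ := he
  -- The oracle carries a code of the finite list `w`. The open set of points whose ideal contains
  -- `w` thereby gets a name computable from `w`, to which overtness applies.
  let Q : List ℕ → List ℕ → Prop := fun o q => ∃ b, o[0]? = some b ∧
    ∀ a ∈ Denumerable.ofNat (List ℕ) b, ∃ i, PrefixOutput c q i a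
  have hQ : REPred fun x : List ℕ × List ℕ => Q x.1 x.2 := by
    have h1 : REPred fun y : ((((List ℕ × List ℕ) × ℕ)) × ℕ) × ℕ =>
        PrefixOutput c y.1.1.1.2 y.2 y.1.2 :=
      PrefixOutput.re (Computable.const c) (Computable.snd.comp (Computable.fst.comp
        (Computable.fst.comp Computable.fst))) Computable.snd (Computable.snd.comp Computable.fst)
    have h2 : REPred fun y : (List ℕ × List ℕ) × ℕ =>
        ∀ a ∈ Denumerable.ofNat (List ℕ) y.2, ∃ i, PrefixOutput c y.1.2 i a :=
      REPred.forall_mem (P := fun (y : (List ℕ × List ℕ) × ℕ) a =>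
        ∃ i, PrefixOutput c y.1.2 i a) (REPred.exists h1)
        ((Primrec.ofNat (List ℕ)).to_comp.comp Computable.snd)
    exact REPred.exists (REPred.and (REPred.getElem?_eq_some
      (Computable.fst.comp Computable.fst) (Computable.const 0) Computable.snd) h2)
  obtain ⟨i, hi⟩ := exists_openName hQ δ
  have hname : ∀ w : List ℕ, ∃ hU, (opensRep δ).IsName (codeName i fun _ => Encodable.encode w)
      ⟨fun x => ∀ a ∈ w, a ∈ (e x).carrier, hU⟩ := by
    intro w
    refine hi _ _ fun q x hq => ?_
    obtain ⟨r, hr, hrx⟩ := hc q x hq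
    have hrx' : (e x).carrier = Set.range r := hrx
    rw [hrx']
    constructor
    · intro hw
      have : ∀ a, ∃ j, a ∈ w → r j = a := by
        intro a
        by_cases ha : a ∈ w
        · obtain ⟨j, hj⟩ := hw a ha
          exact ⟨j, fun _ => hj⟩
        · exact ⟨0, fun h => absurd h ha⟩
      choose f hf using this
      -- `f a` is a place where `a` is enumerated; the length must exceed all these places.
      obtain ⟨k, hk⟩ := hr.exists_prefixOutputs (w.toFinset.sup f + 1)
      refine ⟨k + 1, _, initSeg_getElem? _ (Nat.succ_pos k), fun a ha => ⟨f a, ?_⟩⟩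
      rw [Denumerable.ofNat_encode] at ha
      have hlt : f a < w.toFinset.sup f + 1 :=
        Nat.lt_succ_of_le (Finset.le_sup (List.mem_toFinset.2 ha))
      have := hk (k + 1) (Nat.le_succ k) (f a) (List.mem_range.2 (by simpa using hlt))
      rwa [initSeg_getD r hlt, hf a ha] at this
    · rintro ⟨k, b, hb, h⟩ a ha
      rw [← eq_of_initSeg_getElem? hb, Denumerable.ofNat_encode] at h
      obtain ⟨j, hj⟩ := h a ha
      exact ⟨j, (hj.eq_of_computes hr).symm⟩
  obtain ⟨d, hd⟩ := hover
  have hre : REPred fun y : List ℕ × ℕ =>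
      Accepts d (initSeg (codeName i fun _ => Encodable.encode y.1) y.2) :=
    Accepts.re (Computable.const d)
      (primrec_initSeg_codeName_const i (Primrec.encode.comp Primrec.fst) Primrec.snd).to_comp
  refine (REPred.exists (P := fun (w : List ℕ) k =>
    Accepts d (initSeg (codeName i fun _ => Encodable.encode w) k)) hre).of_eq fun w => ?_
  obtain ⟨hU, hw⟩ := hname w
  obtain ⟨r, hr, hr0⟩ := hd _ _ hw
  have hr0' : (∃ x, ∀ a ∈ w, a ∈ (e x).carrier) ↔ r ≠ 0 := hr0
  rw [hr0']
  constructor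
  · rintro ⟨k, hk⟩
    exact hr.ne_zero_of_accepts hk
  · intro h
    obtain ⟨K, hK⟩ := hr.exists_accepts h
    exact ⟨K, hK K le_rfl⟩

/-- A non-empty discrete quasi-Polish space has a computable surjection from the natural numbers. -/
theorem exists_surjective_of_quasiPolish [Nonempty X] {δ : BaireRepresentation X}
    (hδ : IsComputablyDiscrete δ) (hQP : IsComputablyQuasiPolish δ) :
    ∃ s : ℕ → X, IsComputableMap natRep δ s ∧ Function.Surjective s := by
  obtain ⟨⟨ll, -, -, e, he, he'⟩, hover⟩ := hQP
  have hext := exists_re_extendible hover he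
  obtain ⟨E, hE, hsound, hcomplete⟩ := (hδ.of_injective he' e.symm.injective).exists_re
  have hmem : ∀ (I : RelIdeal ll) p, (idealRep ll).IsName p I → ∀ k, ∀ a ∈ initSeg p k,
      a ∈ I.carrier := by
    intro I p hp k a ha
    obtain ⟨i, -, hi⟩ := mem_initSeg.1 ha
    have hp' : I.carrier = Set.range p := hp
    rw [hp']
    exact ⟨i, hi⟩
  have hEE := REPred.comp hE ((Computable.id (α := List ℕ)).pair Computable.id)
  have hgood := hext.and hEE
  -- Take a prefix of a name long enough for the equality test of that name with itself to accept.
  have hex : ∀ x, ∃ w : List ℕ, (∀ a ∈ w, a ∈ (e x).carrier) ∧ E w w := by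
    intro x
    obtain ⟨p, hp⟩ := (idealRep ll).surjective (e x)
    obtain ⟨K, hK⟩ := hcomplete p p _ hp hp
    exact ⟨initSeg p K, hmem _ p hp K, hK K le_rfl K le_rfl⟩
  -- A list contained in an ideal can be put in front of any enumeration of it. Both ideals thus
  -- have names that begin with `w`, and soundness of `E` identifies the points.
  have huniq : ∀ (w : List ℕ), E w w → ∀ x y, (∀ a ∈ w, a ∈ (e x).carrier) →
      (∀ a ∈ w, a ∈ (e y).carrier) → x = y := by
    intro w hw x y hx hy
    have hext : ∀ z, (∀ a ∈ w, a ∈ (e z).carrier) →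
        ∃ p, (idealRep ll).IsName p (e z) ∧ initSeg p w.length = w := by
      intro z hz
      obtain ⟨q, hq⟩ := (idealRep ll).surjective (e z)
      have hq' : (e z).carrier = Set.range q := hq
      refine ⟨fun i => if h : i < w.length then w[i] else q (i - w.length), ?_, ?_⟩
      · refine hq'.trans (Set.ext fun a => ⟨?_, ?_⟩)
        · rintro ⟨i, rfl⟩
          exact ⟨i + w.length, by simp⟩
        · rintro ⟨i, rfl⟩
          rw [← hq']
          by_cases h : i < w.length
          · simpa [h] using hz _ (List.getElem_mem h)
          · rw [hq']
            simp [h]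
      · refine (eq_initSeg_of_getD fun i hi => ?_).symm
        simp [hi]
    obtain ⟨p, hp, hpw⟩ := hext x hx
    obtain ⟨q, hq, hqw⟩ := hext y hy
    refine e.injective (hsound p q _ _ hp hq w.length w.length ?_)
    rwa [hpw, hqw]
  obtain ⟨x₀⟩ := ‹Nonempty X›
  obtain ⟨w₀, hw₀, hEw₀⟩ := hex x₀
  obtain ⟨g, hg, hgP, hgsurj⟩ := hgood.exists_enumeration (b := w₀) ⟨⟨x₀, hw₀⟩, hEw₀⟩
  choose s hs using fun n => (hgP n).1
  -- Only one ideal contains `g n`, so its elements are the `v` for which `v :: g n` is extendible.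
  have hsE : IsComputableMap natRep (idealRep ll) fun n => e (s n) := by
    have h : REPred fun y : (List ℕ × ℕ) × ℕ => y.1.1[0]? = some y.2 ∧
        ∃ x, ∀ a ∈ y.1.2 :: g y.2, a ∈ (e x).carrier := by
      have hcons : Computable fun y : (List ℕ × ℕ) × ℕ => y.1.2 :: g y.2 :=
        Computable.list_cons.comp (Computable.snd.comp Computable.fst) (hg.comp Computable.snd)
      have h2 := REPred.comp hext hcons
      exact REPred.and (REPred.getElem?_eq_some (Computable.fst.comp Computable.fst)
        (Computable.const 0) Computable.snd) h2
    obtain ⟨c, hc⟩ := exists_code_enumerate (Q := fun w v => ∃ n, w[0]? = some n ∧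
      ∃ x, ∀ a ∈ v :: g n, a ∈ (e x).carrier) (REPred.exists h)
    refine ⟨c, ?_⟩
    rintro p _ rfl
    have hset : {v | ∃ k n, (initSeg p k)[0]? = some n ∧
        ∃ x, ∀ a ∈ v :: g n, a ∈ (e x).carrier} = (e (s (p 0))).carrier := by
      refine Set.ext fun v => ⟨?_, fun hv => ?_⟩
      · rintro ⟨k, n, hn, x, hx⟩
        rw [← eq_of_initSeg_getElem? hn] at hx
        rw [List.forall_mem_cons] at hx
        rw [← huniq _ (hgP (p 0)).2 x _ hx.2 (hs (p 0))]
        exact hx.1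
      · exact ⟨1, p 0, initSeg_getElem? p Nat.one_pos, s (p 0),
          List.forall_mem_cons.2 ⟨hv, hs (p 0)⟩⟩
    obtain ⟨v, hv⟩ := (e (s (p 0))).nonempty
    rw [← hset] at hv
    obtain ⟨k, hk⟩ := hv
    obtain ⟨r, hr, hrange⟩ := hc p ⟨k, v, hk⟩
    exact ⟨r, hr, (hrange.trans hset).symm⟩
  have hsδ := he'.comp hsE
  refine ⟨s, ?_, fun x => ?_⟩
  · have : (e.symm ∘ fun n => e (s n)) = s := funext fun n => e.symm_apply_apply _
    rwa [this] at hsδ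
  · obtain ⟨w, hw, hEw⟩ := hex x
    obtain ⟨n, rfl⟩ := hgsurj w ⟨⟨x, hw⟩, hEw⟩
    exact ⟨n, huniq _ hEw _ _ (hs n) hw⟩

/-! ### Admissible quotients -/

/-- Each singleton of the quotient is open, with a name computable from a representative `n`. It
belongs to the neighbourhood filter of `x` if and only if `n` represents `x`, so a search recovers
`x`. -/
theorem IsCeer.isComputablyAdmissible {R : Setoid ℕ} (hR : IsCeer R) :
    IsComputablyAdmissible (natQuotientRep R) := by
  classical
  obtain ⟨i, hi⟩ := exists_openName hR.headsRelated_re (natQuotientRep R)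
  have hname : ∀ n, ∃ hU, (opensRep (natQuotientRep R)).IsName (codeName i fun _ => n)
      ⟨fun z => Quotient.mk R n = z, hU⟩ := by
    intro n
    refine hi _ _ fun q x hq => ?_
    rw [exists_headsRelated_iff, ← natQuotientRep_isName_iff.1 hq]
    exact Quotient.eq
  choose hU hname using hname
  have hinj : Function.Injective (nbhdFilter (natQuotientRep R)) := by
    intro x y hxy
    induction x using Quotient.inductionOn with | h n =>
    have h := congrFun (congrArg Subtype.val hxy) ⟨_, hU n⟩
    exact h.mp rfl
  -- Choice only fixes the inverse on the range of the neighbourhood map, where `hinj` leaves no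
  -- freedom; the realiser is the search below.
  refine ⟨fun V => ⟨∃ x, nbhdFilter _ x = V, fun h => h.choose⟩, ?_, fun x => ?_⟩
  · have h : REPred fun y : ((List ℕ × ℕ) × ℕ) × ℕ =>
        CodeAccepts y.1.1.1 (initSeg (codeName i fun _ => y.1.2) y.2) := by
      refine CodeAccepts.re ?_ (primrec_initSeg_codeName_const i ?_ Primrec.snd)
      · exact Primrec.fst.comp (Primrec.fst.comp Primrec.fst)
      · exact Primrec.snd.comp Primrec.fst
    obtain ⟨c, hc⟩ := exists_code_search (P := fun u _ n => ∃ k,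
      CodeAccepts u (initSeg (codeName i fun _ => n) k)) (REPred.exists h)
    refine ⟨c, ?_⟩
    rintro p V x hp ⟨hV, hx⟩
    have hVx : nbhdFilter _ x = V := hx ▸ hV.choose_spec
    subst hVx
    obtain ⟨r, hr, h⟩ := hc p fun _ => by
      induction x using Quotient.inductionOn with | h n =>
      obtain ⟨k, hk⟩ := (mem_iff_codeAccepts hp (hname n)).1 rfl
      exact ⟨k, n, k, hk⟩
    obtain ⟨k, l, hkl⟩ := h 0
    exact ⟨r, hr, natQuotientRep_isName_iff.2 (mem_of_codeAccepts hp (hname (r 0)) hkl)⟩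
  · have hx : ∃ y, nbhdFilter _ y = nbhdFilter (natQuotientRep R) x := ⟨x, rfl⟩
    exact ⟨hx, hinj hx.choose_spec⟩

/-- If the quotient by `R` is admissible, then `R` is computably enumerable: the condition that an
open set contains both `n` and `m` defines a neighbourhood filter if and only if `n` and `m` are
related, and it can be refined later both to the neighbourhood filter of `n` and to that of `m`. -/
theorem isCeer_of_isComputablyAdmissible {R : Setoid ℕ}
    (h : IsComputablyAdmissible (natQuotientRep R)) : IsCeer R := by
  obtain ⟨G, ⟨c, hc⟩, hG⟩ := h
  -- The oracle is a sequence of pairs, and `U` is accepted once it contains both components of one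
  -- of them. Using a whole sequence leaves room to append different pairs later.
  let Q : List ℕ → List ℕ → Prop := fun o u => ∃ j : ℕ, ∃ a k : ℕ, o[j]? = some a ∧
    CodeAccepts u (initSeg (fun _ => a.unpair.1) k) ∧
    CodeAccepts u (initSeg (fun _ => a.unpair.2) k)
  have hQ : REPred fun x : List ℕ × List ℕ => Q x.1 x.2 := by
    have hu : Primrec fun y : (((List ℕ × List ℕ) × ℕ) × ℕ) × ℕ => y.1.1.1.2 :=
      Primrec.snd.comp (Primrec.fst.comp (Primrec.fst.comp Primrec.fst))
    have ha : Primrec fun y : (((List ℕ × List ℕ) × ℕ) × ℕ) × ℕ => y.1.2 :=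
      Primrec.snd.comp Primrec.fst
    have h1 : REPred fun y : (((List ℕ × List ℕ) × ℕ) × ℕ) × ℕ =>
        y.1.1.1.1[y.1.1.2]? = some y.1.2 ∧
          CodeAccepts y.1.1.1.2 (initSeg (fun _ => y.1.2.unpair.1) y.2) ∧
          CodeAccepts y.1.1.1.2 (initSeg (fun _ => y.1.2.unpair.2) y.2) := by
      refine REPred.and (REPred.getElem?_eq_some ?_ ?_ ha.to_comp) (REPred.and
        (CodeAccepts.re hu (primrec_initSeg_const ?_ Primrec.snd))
        (CodeAccepts.re hu (primrec_initSeg_const ?_ Primrec.snd)))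
      · exact Computable.fst.comp (Computable.fst.comp (Computable.fst.comp Computable.fst))
      · exact Computable.snd.comp (Computable.fst.comp Computable.fst)
      · exact Primrec.fst.comp (Primrec.unpair.comp ha)
      · exact Primrec.snd.comp (Primrec.unpair.comp ha)
    exact REPred.exists (REPred.exists (REPred.exists h1))
  obtain ⟨i, hi⟩ := exists_openName hQ (opensRep (natQuotientRep R))
  -- If every pair meets the class `x`, acceptance of `U` implies `x ∈ U`. If some pair lies
  -- entirely in `x`, the converse holds.
  have hname : ∀ (o : ℕ → ℕ) (x : Quotient R),
      (∀ j, Quotient.mk R (o j).unpair.1 = x ∨ Quotient.mk R (o j).unpair.2 = x) →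
      (∃ j, Quotient.mk R (o j).unpair.1 = x ∧ Quotient.mk R (o j).unpair.2 = x) →
      (opensRep (opensRep (natQuotientRep R))).IsName (codeName i o) (nbhdFilter _ x) := by
    intro o x hor hand
    obtain ⟨hU, h⟩ := hi o (nbhdFilter _ x).1 fun q U hq => by
      change U.1 x ↔ _
      constructor
      · intro hx
        obtain ⟨j, h1, h2⟩ := hand
        obtain ⟨K, hK⟩ := exists_codeAccepts_of_mem hq
          (natQuotientRep_isName_const R (o j).unpair.1) (h1 ▸ hx)
        obtain ⟨L, hL⟩ := exists_codeAccepts_of_mem hq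
          (natQuotientRep_isName_const R (o j).unpair.2) (h2 ▸ hx)
        exact ⟨max (j + 1) (max K L), j, o j, max K L, initSeg_getElem? o (by omega),
          hK _ (by omega) _ (by omega), hL _ (by omega) _ (by omega)⟩
      · rintro ⟨k, j, a, l, ha, h1, h2⟩
        rw [← eq_of_initSeg_getElem? ha] at h1 h2
        rcases hor j with hj | hj
        · exact hj ▸ mem_of_codeAccepts hq (natQuotientRep_isName_const R _) h1
        · exact hj ▸ mem_of_codeAccepts hq (natQuotientRep_isName_const R _) h2
    exact h
  have hre : REPred fun y : ((ℕ × ℕ) × ℕ) × ℕ =>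
      PrefixOutput c (initSeg (codeName i fun _ => Nat.pair y.1.1.1 y.1.1.2) y.1.2) 0 y.2 := by
    refine PrefixOutput.re (Computable.const c) (primrec_initSeg_codeName_const i
      (Primrec₂.natPair.comp ?_ ?_) (Primrec.snd.comp Primrec.fst)).to_comp
      (Computable.const 0) Computable.snd
    · exact Primrec.fst.comp (Primrec.fst.comp Primrec.fst)
    · exact Primrec.snd.comp (Primrec.fst.comp Primrec.fst)
  -- `n` and `m` are related if and only if the machine for the inverse yields a first output on the
  -- constant oracle `Nat.pair n m`.
  refine (REPred.exists (P := fun (x : ℕ × ℕ) k => ∃ v,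
    PrefixOutput c (initSeg (codeName i fun _ => Nat.pair x.1 x.2) k) 0 v)
    (REPred.exists hre)).of_eq ?_
  rintro ⟨n, m⟩
  constructor
  · rintro ⟨k, v, hv⟩
    have hval : ∀ l, l = n ∨ l = m → Quotient.mk R v = Quotient.mk R l := by
      intro l hl
      -- Changing the oracle beyond the part read gives a name of the neighbourhood filter of `l`.
      -- The output `v` stays the same, so it represents the class of `l`, both for `l = n` and for
      -- `l = m`.
      let o : ℕ → ℕ := fun j => if j < k then Nat.pair n m else Nat.pair l l
      obtain ⟨r, hr, hrl⟩ := hc (codeName i o) _ _ (hname o (Quotient.mk R l) (fun j => by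
        by_cases hj : j < k
        · rcases hl with rfl | rfl <;> simp [o, hj]
        · simp [o, hj]) ⟨k, by simp [o]⟩) (hG _)
      have hseg : initSeg (codeName i fun _ => Nat.pair n m) k = initSeg (codeName i o) k :=
        initSeg_congr (codeName_congr fun j hj => by simp [o, hj])
      change PrefixOutput c (initSeg (codeName i fun _ => Nat.pair n m) k) 0 v at hv
      rw [hseg] at hv
      rw [hv.eq_of_computes hr]
      exact natQuotientRep_isName_iff.1 hrl
    exact Quotient.exact ((hval n (Or.inl rfl)).symm.trans (hval m (Or.inr rfl)))
  · intro hnm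
    have hnm' : Quotient.mk R n = Quotient.mk R m := Quotient.sound hnm
    obtain ⟨r, hr, -⟩ := hc _ _ _ (hname (fun _ => Nat.pair n m) (Quotient.mk R n)
      (fun j => by simp) ⟨0, by simp [hnm']⟩) (hG _)
    obtain ⟨k, hk⟩ := mem_oracleEval_iff.1 (hr 0)
    exact ⟨k, _, hk⟩

end RepresentedSpaces

/-! ### The two lists of equivalences -/

theorem theorem14 {X : Type*} [Nonempty X] (δ : BaireRepresentation X) :
    (IsComputablyDiscrete δ → List.TFAE [
      ∃ δ' : BaireRepresentation X, δ'.dom = Set.univ ∧ IsComputablyEquivalent δ δ',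
      ∃ s : ℕ → X, IsComputableMap natRep δ s ∧ Function.Surjective s,
      IsComputablyQuasiPolish δ,
      ∃ R : Setoid ℕ, IsComputablyDiscrete (natQuotientRep R) ∧
        IsComputablyIsomorphic δ (natQuotientRep R),
      ∃ R : Setoid ℕ, IsComputablyAdmissible (natQuotientRep R) ∧
        IsComputablyIsomorphic δ (natQuotientRep R)]) ∧
    List.TFAE [
      IsComputablyDiscrete δ ∧ IsComputablyQuasiPolish δ,
      ∃ R : Setoid ℕ, IsComputablyAdmissible (natQuotientRep R) ∧
        IsComputablyIsomorphic δ (natQuotientRep R),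
      ∃ R : Setoid ℕ, IsCeer R ∧ IsComputablyIsomorphic δ (natQuotientRep R)] := by
  refine ⟨fun hδ => ?_, ?_⟩
  · tfae_have 1 → 2 := fun ⟨_, htot, heq⟩ => exists_surjective_of_total hδ htot heq
    tfae_have 2 → 1 := fun ⟨_, hs, hsurj⟩ => exists_total_of_surjective hδ hs hsurj
    tfae_have 2 → 4 := fun ⟨_, hs, hsurj⟩ => exists_quotient_of_surjective hδ hs hsurj
    tfae_have 4 → 5 := fun ⟨R, hR, h⟩ =>
      ⟨R, (isCeer_of_isComputablyDiscrete hR).isComputablyAdmissible, h⟩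
    tfae_have 5 → 3 := fun ⟨_, hR, h⟩ =>
      isComputablyQuasiPolish_of_isCeer (isCeer_of_isComputablyAdmissible hR) h
    tfae_have 3 → 2 := exists_surjective_of_quasiPolish hδ
    tfae_finish
  · tfae_have 1 → 3 := by
      rintro ⟨hδ, hQP⟩
      obtain ⟨s, hs, hsurj⟩ := exists_surjective_of_quasiPolish hδ hQP
      obtain ⟨R, hR, h⟩ := exists_quotient_of_surjective hδ hs hsurj
      exact ⟨R, isCeer_of_isComputablyDiscrete hR, h⟩
    tfae_have 3 → 1 := by
      rintro ⟨R, hR, h⟩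
      refine ⟨?_, isComputablyQuasiPolish_of_isCeer hR h⟩
      obtain ⟨e, he, -⟩ := h
      exact hR.isComputablyDiscrete.of_injective he e.injective
    tfae_have 3 → 2 := fun ⟨R, hR, h⟩ => ⟨R, hR.isComputablyAdmissible, h⟩
    tfae_have 2 → 3 := fun ⟨R, hR, h⟩ => ⟨R, isCeer_of_isComputablyAdmissible hR, h⟩
    tfae_finish
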